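/- Let $\mathbb{S}=\{0,1\}^*$ be the set of finite binary strings (situations), $\square$ the empty string, $\Omega=\{0,1\}^{\mathbb{N}}$ the set of infinite binary sequences (paths) with its Borel $\sigma$-algebra for the Cantor topology, and, for $s\in\mathbb{S}$, let $[s]\subseteq\Omega$ be the cylinder set of all paths with initial segment $s$. A \emph{forecasting system} $\varphi$ maps every $s\in\mathbb{S}$ to a non-empty closed interval $\varphi(s)=[\underline{\varphi}(s),\overline{\varphi}(s)]\subseteq[0,1]$; it is \emph{precise} if $\underline{\varphi}=\overline{\varphi}$, and $\psi\subseteq\varphi$ means that $\psi(s)\subseteq\varphi(s)$ for all $s\in\mathbb{S}$. A \emph{supermartingale} for $\varphi$ is a map $M\colon\mathbb{S}\to\mathbb{R}$ with $\max_{p\in\varphi(s)}[pM(s1)+(1-p)M(s0)]\le M(s)$ for all $s\in\mathbb{S}$, and a \emph{submartingale} is the negative of a supermartingale. For $G\subseteq\Omega$ with indicator $\mathbb{I}_G$, the upper probability $\overline{P}^{\varphi}(G)$ is the infimum of $M(\square)$ over all supermartingales $M$ for $\varphi$ with $\liminf_{n}M(\omega_{1:n})\ge\mathbb{I}_G(\omega)$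 for all $\omega\in\Omega$, and the lower probability $\underline{P}^{\varphi}(G)$ is the supremum of $M(\square)$ over all submartingales $M$ for $\varphi$ with $\limsup_{n}M(\omega_{1:n})\le\mathbb{I}_G(\omega)$ for all $\omega\in\Omega$. For a precise forecasting system $\varphi_{\mathrm{pr}}$, the measure $\mu^{\varphi_{\mathrm{pr}}}$ generated by it is the probability measure on the Borel sets with $\mu^{\varphi_{\mathrm{pr}}}(G)=\underline{P}^{\varphi_{\mathrm{pr}}}(G)=\overline{P}^{\varphi_{\mathrm{pr}}}(G)$ for all Borel $G\subseteq\Omega$. A map $r\colon\mathbb{S}\to\mathbb{R}$ is \emph{lower semicomputable} if it is the pointwise limit $r(s)=\lim_n q(s,n)$ of a recursive map $q\colon\mathbb{S}\times\mathbb{N}_0\to\mathbb{Q}$ that is non-decreasing in $n$, \emph{upper semicomputable} if $-r$ is lower semicomputable, and \emph{computable} if it is both; $\varphi$ is \emph{computable} if $\underline{\varphi}$ and $\overline{\varphi}$ are computable. Let $\mathcal{M}(\Omega)$ be the set of all Borel probability measures on $\Omega$. For a finite $b\subseteq\mathbb{Q}\times\mathbb{S}\times\mathbb{Q}$, let $b(\Omega)=\{\mu\in\mathcal{M}(\Omega):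 u<\mu([s])<v\text{ for all }(u,s,v)\in b\}$; these are the basic open sets of $\mathcal{M}(\Omega)$. A set $\mathcal{C}\subseteq\mathcal{M}(\Omega)$ is \emph{effectively closed} if $\mathcal{M}(\Omega)\setminus\mathcal{C}=\bigcup_{b\in B}b(\Omega)$ for some recursively enumerable set $B$ of finite subsets of $\mathbb{Q}\times\mathbb{S}\times\mathbb{Q}$. It is \emph{effectively compact} if it is compact and the set of all finite collections $B$ of finite subsets of $\mathbb{Q}\times\mathbb{S}\times\mathbb{Q}$ with $\mathcal{C}\subseteq\bigcup_{b\in B}b(\Omega)$ is recursively enumerable. \textbf{Proposition.} Let $\varphi$ be a computable forecasting system for which $\underline{\varphi}$ is lower semicomputable and $\overline{\varphi}$ is upper semicomputable. Then every precise forecasting system $\varphi_{\mathrm{pr}}\subseteq\varphi$ generates exactly one probability measure $\mu^{\varphi_{\mathrm{pr}}}$, and the class $$\{\mu^{\varphi_{\mathrm{pr}}}:\varphi_{\mathrm{pr}}\text{ is a precise forecasting system with }\varphi_{\mathrm{pr}}\subseteq\varphi\}$$ is effectively closed and effectively compact. -/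

import Mathlib

noncomputable section

namespace Forecasting

open MeasureTheory Filter Topology

/-! ### The event tree -/

/-- Situations: finite strings of binary outcomes (`true` is the outcome 1, `false` is 0). -/
abbrev Situation : Type := List Bool

/-- Paths: infinite binary outcome sequences. The first outcome is `ω 0`. The measurable space
structure is the product one, which is the Borel σ-algebra of the Cantor topology. -/
abbrev Path : Type := ℕ → Bool

/-- The initial segment of length `n` of a path. -/
def initSeg (ω : Path) (n : ℕ) : Situation := (List.range n).map ω

/-- The cylinder set of all paths going through the situation `s`. -/
def cylinderSet (s : Situation) : Set Path := {ω | ∃ n, initSeg ω n = s}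

/-! ### Forecasting systems -/

/-- Interval forecasts: non-empty closed subintervals of the real unit interval. -/
abbrev IntervalForecast : Type := NonemptyInterval unitInterval

/-- A forecasting system attaches an interval forecast to every situation. -/
abbrev ForecastingSystem : Type := Situation → IntervalForecast

/-- The lower bound of a forecasting system, as a real process. -/
def lowerBound (φ : ForecastingSystem) (s : Situation) : ℝ := ((φ s).fst : ℝ)

/-- The upper bound of a forecasting system, as a real process. -/
def upperBound (φ : ForecastingSystem) (s : Situation) : ℝ := ((φ s).snd : ℝ)

/-- A forecasting system is precise if its lower and upper bounds coincide. -/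
def IsPrecise (φ : ForecastingSystem) : Prop := lowerBound φ = upperBound φ

/-- `Compatible ψ φ` says that `ψ(s) ⊆ φ(s)` in every situation `s`. -/
def Compatible (ψ φ : ForecastingSystem) : Prop :=
  ∀ s, ((ψ s : IntervalForecast) : Set unitInterval) ⊆ (φ s : Set unitInterval)

/-! ### Global upper and lower expectations -/

/-- The local expectation of a gamble on a binary outcome, for the precise forecast `p`. -/
def localExp (p : ℝ) (f : Bool → ℝ) : ℝ := p * f true + (1 - p) * f false

/-- The local upper expectation associated with an interval forecast. -/
def localUpperExp (I : IntervalForecast) (f : Bool → ℝ) : ℝ :=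
  sSup ((fun p : unitInterval => localExp (p : ℝ) f) '' (I : Set unitInterval))

/-- Supermartingales: real processes whose local upper expectation never exceeds the current
value. -/
def IsSupermartingale (φ : ForecastingSystem) (M : Situation → ℝ) : Prop :=
  ∀ s, localUpperExp (φ s) (fun x => M (s ++ [x])) ≤ M s

/-- Submartingales: the negatives of supermartingales. -/
def IsSubmartingale (φ : ForecastingSystem) (M : Situation → ℝ) : Prop :=
  IsSupermartingale φ (fun s => -M s)

/-- The (unconditional) global upper expectation of a global gamble `g`. The limit inferior may be
infinite, so it is taken in the extended reals. -/
def globalUpperExp (φ : ForecastingSystem) (g : Path → ℝ) : ℝ :=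
  sInf {x : ℝ | ∃ M, IsSupermartingale φ M ∧
    (∀ ω, (g ω : EReal) ≤ liminf (fun n => (M (initSeg ω n) : EReal)) atTop) ∧ x = M []}

/-- The (unconditional) global lower expectation of a global gamble `g`. -/
def globalLowerExp (φ : ForecastingSystem) (g : Path → ℝ) : ℝ :=
  sSup {x : ℝ | ∃ M, IsSubmartingale φ M ∧
    (∀ ω, limsup (fun n => (M (initSeg ω n) : EReal)) atTop ≤ (g ω : EReal)) ∧ x = M []}

/-- The global upper probability of an event. -/
def upperProb (φ : ForecastingSystem) (G : Set Path) : ℝ :=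
  globalUpperExp φ (G.indicator fun _ => 1)

/-- The global lower probability of an event. -/
def lowerProb (φ : ForecastingSystem) (G : Set Path) : ℝ :=
  globalLowerExp φ (G.indicator fun _ => 1)

/-- `Generates ψ μ` says that `μ` is the probability measure of the (precise) forecasting system
`ψ`: on every Borel event, `μ` is the common value of the global lower and upper probabilities. -/
def Generates (ψ : ForecastingSystem) (μ : ProbabilityMeasure Path) : Prop :=
  ∀ G : Set Path, MeasurableSet G → lowerProb ψ G = μ G ∧ upperProb ψ G = μ G

/-- The class of all probability measures generated by the precise forecasting systems that are
compatible with `φ`. -/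
def compatibleMeasures (φ : ForecastingSystem) : Set (ProbabilityMeasure Path) :=
  {μ | ∃ ψ, IsPrecise ψ ∧ Compatible ψ φ ∧ Generates ψ μ}

/-! ### Encodings and computability

A set whose elements are encoded by the elements of a `Primcodable` type `C` comes with a decoding
map from `C` onto the set. -/

/-- Codes of rational numbers. -/
abbrev RatCode : Type := ℕ × ℕ × ℕ

/-- The code `(a, b, k)` stands for the rational number `(a - b) / (k + 1)`. -/
def decodeRat (c : RatCode) : ℚ := ((c.1 : ℚ) - c.2.1) / (c.2.2 + 1)

theorem decodeRat_surjective : Function.Surjective decodeRat := by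
  intro q
  refine ⟨(q.num.toNat, (-q.num).toNat, q.den - 1), ?_⟩
  have h1 : ((q.num.toNat : ℤ) - ((-q.num).toNat : ℤ)) = q.num := by omega
  have h2 : ((q.num.toNat : ℚ) - ((-q.num).toNat : ℚ)) = q.num := by exact_mod_cast h1
  have h3 : (((q.den - 1 : ℕ) : ℚ) + 1) = q.den := by
    have := q.den_pos
    have h : q.den - 1 + 1 = q.den := by omega
    exact_mod_cast h
  simp only [decodeRat]
  rw [h2, h3, Rat.num_div_den]

/-- Generators of basic open sets: finite subsets of `ℚ × 𝕊 × ℚ`. -/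
abbrev Generator : Type := Finset (ℚ × Situation × ℚ)

/-- Codes of generators: lists of triples. -/
abbrev GeneratorCode : Type := List (RatCode × Situation × RatCode)

/-- A generator is encoded by any list of (codes of) its elements. -/
def decodeGenerator (c : GeneratorCode) : Generator :=
  (c.map fun t => (decodeRat t.1, t.2.1, decodeRat t.2.2)).toFinset

theorem decodeGenerator_surjective : Function.Surjective decodeGenerator := by
  intro b
  have h : Function.Surjective
      (fun t : RatCode × Situation × RatCode => (decodeRat t.1, t.2.1, decodeRat t.2.2)) := by
    rintro ⟨u, s, v⟩
    obtain ⟨cu, rfl⟩ := decodeRat_surjective u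
    obtain ⟨cv, rfl⟩ := decodeRat_surjective v
    exact ⟨(cu, s, cv), rfl⟩
  obtain ⟨c, hc⟩ := List.map_surjective_iff.2 h b.toList
  exact ⟨c, by simp only [decodeGenerator, hc, Finset.toList_toFinset]⟩

/-- A finite set of generators is encoded by any list of codes of its elements. -/
def decodeFamily (c : List GeneratorCode) : Finset Generator := (c.map decodeGenerator).toFinset

theorem decodeFamily_surjective : Function.Surjective decodeFamily := by
  intro B
  obtain ⟨c, hc⟩ := List.map_surjective_iff.2 decodeGenerator_surjective B.toList
  exact ⟨c, by simp only [decodeFamily, hc, Finset.toList_toFinset]⟩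

/-- A set `S` is recursively enumerable, with respect to a decoding map, if there is a partial
recursive procedure that halts on exactly the codes of elements of `S`. -/
def RecEnum {C D : Type} [Primcodable C] (decode : C → D) (S : Set D) : Prop :=
  REPred fun c => decode c ∈ S

/-- Recursive rational maps: a code of the value is computable from the argument. -/
def RecursiveRat {D : Type} [Primcodable D] (q : D → ℚ) : Prop :=
  ∃ c : D → RatCode, Computable c ∧ ∀ d, decodeRat (c d) = q d

/-- Lower semicomputable real maps: limits of non-decreasing recursive sequences of rational
maps. -/
def LowerSemicomputable {D : Type} [Primcodable D] (r : D → ℝ) : Prop :=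
  ∃ q : D × ℕ → ℚ, RecursiveRat q ∧ (∀ d n, q (d, n) ≤ q (d, n + 1)) ∧
    ∀ d, Tendsto (fun m => (q (d, m) : ℝ)) atTop (𝓝 (r d))

/-- Upper semicomputable real maps. -/
def UpperSemicomputable {D : Type} [Primcodable D] (r : D → ℝ) : Prop :=
  LowerSemicomputable fun d => -r d

/-- Computable real maps. -/
def ComputableReal {D : Type} [Primcodable D] (r : D → ℝ) : Prop :=
  LowerSemicomputable r ∧ UpperSemicomputable r

/-- A forecasting system is computable if its lower and upper bounds are. -/
def ComputableForecast (φ : ForecastingSystem) : Prop :=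
  ComputableReal (lowerBound φ) ∧ ComputableReal (upperBound φ)

/-! ### Effective topology on the set of probability measures -/

/-- The basic open set of all probability measures `μ` with `u < μ(cylinderSet s) < v` for all
`(u, s, v) ∈ b`. -/
def basicOpen (b : Generator) : Set (ProbabilityMeasure Path) :=
  {μ | ∀ t ∈ b, (t.1 : ℝ) < μ (cylinderSet t.2.1) ∧ (μ (cylinderSet t.2.1) : ℝ) < t.2.2}

/-- The topology on the set of probability measures generated by the basic open sets. -/
abbrev measureTopology : TopologicalSpace (ProbabilityMeasure Path) :=
  TopologicalSpace.generateFrom (Set.range basicOpen)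

/-- Effectively open: the union of a recursively enumerable collection of basic open sets. -/
def EffectivelyOpen (K : Set (ProbabilityMeasure Path)) : Prop :=
  ∃ B : Set Generator, RecEnum decodeGenerator B ∧ ⋃ b ∈ B, basicOpen b = K

/-- Effectively closed: the complement is effectively open. -/
def EffectivelyClosed (K : Set (ProbabilityMeasure Path)) : Prop := EffectivelyOpen Kᶜ

/-- Effectively compact: compact, and the collection of all finite covers by basic open sets is
recursively enumerable. -/
def EffectivelyCompact (K : Set (ProbabilityMeasure Path)) : Prop :=
  @IsCompact _ measureTopology K ∧
    RecEnum decodeFamily {B : Finset Generator | K ⊆ ⋃ b ∈ B, basicOpen b}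

end Forecasting

end

noncomputable section

namespace Forecasting

open MeasureTheory Filter Topology

/-! ### Initial segments and cylinder sets -/

/-! A precise system is a choice of one number `p s` in the unit interval per situation, and its
measure can be built outright: compare independent uniform numbers with the forecasts met along the
way. The resulting random path goes through a situation with probability the product of the one-step
probabilities (`pathMeasure_cylinderSet`).

This measure equals both global probabilities on Borel sets. A supermartingale whose limit inferior
dominates an indicator is non-negative, its expectation at every time is at most its initial value,
and Fatou's lemma bounds the measure by that value (`pathMeasure_le_supermartingale`). Conversely,
by outer regularity the event lies in an open set of nearly the same measure, whose conditional
probabilities form a martingale equal to 1 from some time on along each path in the open set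
(`exists_supermartingale_lt`). Lower probabilities follow by complementation, and uniqueness is
immediate.

The compatible measures are those satisfying linear inequalities between the probabilities of a
cylinder and of its child (`mem_compatibleMeasures_iff`). A violated inequality is strict, so it is
certified by rational bounds on two cylinders and one stage of the approximation of a forecast
bound; such certificates can be enumerated, which gives effective closedness.

The class is also the continuous image of a product of compact intervals, hence compact. To
enumerate its covers, level `m` replaces forecasts by finitely many grid points and asks that each
either visibly violates the bounds or lies in some member of the cover with room for the rounding
error. A Lipschitz estimate (`abs_mass_sub_mass_le`) makes the test sound (`GridTest.cover`); if it
failed at every level, a convergent subsequence of bad grid points would yield a compatible measure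
outside the cover (`exists_gridTest`). -/

theorem initSeg_zero (ω : Path) : initSeg ω 0 = [] := rfl

theorem initSeg_succ (ω : Path) (n : ℕ) : initSeg ω (n + 1) = initSeg ω n ++ [ω n] := by
  simp [initSeg, List.range_succ]

@[simp] theorem length_initSeg (ω : Path) (n : ℕ) : (initSeg ω n).length = n := by
  simp [initSeg]

theorem mem_cylinderSet {s : Situation} {ω : Path} :
    ω ∈ cylinderSet s ↔ initSeg ω s.length = s := by
  constructor
  · rintro ⟨n, rfl⟩
    simp
  · exact fun h => ⟨_, h⟩

theorem initSeg_eq_iff {ω ω' : Path} {n : ℕ} :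
    initSeg ω n = initSeg ω' n ↔ ∀ k < n, ω k = ω' k := by
  simp [initSeg]

theorem exists_initSeg_eq (s : Situation) : ∃ ω : Path, initSeg ω s.length = s := by
  refine ⟨fun n => s.getD n false, ?_⟩
  apply List.ext_getElem
  · simp
  · intro i h1 h2
    simp [initSeg, h2]

theorem cylinderSet_nil : cylinderSet [] = Set.univ := by
  ext ω
  simp [mem_cylinderSet, initSeg]

theorem cylinderSet_append (s : Situation) (b : Bool) :
    cylinderSet (s ++ [b]) = cylinderSet s ∩ {ω | ω s.length = b} := by
  ext ω
  simp [mem_cylinderSet, initSeg_succ]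

theorem measurableSet_cylinderSet (s : Situation) : MeasurableSet (cylinderSet s) := by
  induction s using List.reverseRecOn with
  | nil => simp [cylinderSet_nil]
  | append_singleton s b ih =>
    rw [cylinderSet_append]
    exact ih.inter ((measurable_pi_apply (X := fun _ => Bool) s.length) (measurableSet_singleton b))

theorem eval_preimage_eq_iUnion_cylinderSet (n : ℕ) (b : Bool) :
    {ω : Path | ω n = b} = ⋃ s ∈ {s : Situation | s.length = n}, cylinderSet (s ++ [b]) := by
  ext ω
  simp only [Set.mem_ofPred_eq, Set.mem_iUnion, cylinderSet_append, Set.mem_inter_iff,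
    mem_cylinderSet, exists_prop]
  constructor
  · intro h
    exact ⟨initSeg ω n, by simp, by simp, by simpa using h⟩
  · rintro ⟨s, rfl, -, h⟩
    exact h

theorem generateFrom_cylinderSet :
    (inferInstance : MeasurableSpace Path) = MeasurableSpace.generateFrom (Set.range cylinderSet) := by
  apply le_antisymm
  · refine iSup_le fun n => ?_
    rw [← measurable_iff_comap_le]
    refine @measurable_to_countable' Bool Path _ _ (MeasurableSpace.generateFrom _) _ fun b => ?_
    have h : (fun ω : Path => ω n) ⁻¹' {b} = {ω : Path | ω n = b} := rfl
    rw [h, eval_preimage_eq_iUnion_cylinderSet]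
    refine MeasurableSet.biUnion (Set.to_countable _) fun s _ => ?_
    exact MeasurableSpace.measurableSet_generateFrom ⟨_, rfl⟩
  · refine MeasurableSpace.generateFrom_le ?_
    rintro _ ⟨s, rfl⟩
    exact measurableSet_cylinderSet s

/-- Two cylinders that meet are nested, so their intersection is the one with the longer string. -/
theorem isPiSystem_cylinderSet : IsPiSystem (Set.range cylinderSet) := by
  rintro _ ⟨s, rfl⟩ _ ⟨t, rfl⟩ ⟨ω, hs, ht⟩
  wlog h : s.length ≤ t.length generalizing s t
  · rw [Set.inter_comm]
    exact this t s ht hs (by omega)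
  refine ⟨t, (Set.inter_eq_right.2 ?_).symm⟩
  intro ω' hω'
  rw [mem_cylinderSet] at *
  rw [← ht, length_initSeg, initSeg_eq_iff] at hω'
  rw [← hs, length_initSeg, initSeg_eq_iff]
  exact fun k hk => hω' k (by omega)

theorem measure_ext_of_cylinderSet {μ ν : Measure Path} [IsFiniteMeasure μ]
    (h : ∀ s, μ (cylinderSet s) = ν (cylinderSet s)) : μ = ν := by
  refine ext_of_generate_finite _ generateFrom_cylinderSet isPiSystem_cylinderSet ?_ ?_
  · rintro _ ⟨s, rfl⟩
    exact h s
  · simpa [cylinderSet_nil] using h []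

/-! ### The measure of a precise forecasting system -/

/-- The probability of the outcome `b` in the situation `s` for the precise forecasts `p`. -/
def coin (p : Situation → unitInterval) (s : Situation) (b : Bool) : ℝ :=
  if b then (p s : ℝ) else 1 - p s

/-- The forecasts after the situation `s`. -/
def shift (p : Situation → unitInterval) (s : Situation) : Situation → unitInterval :=
  fun t => p (s ++ t)

/-- The probability of going through a situation, for the precise forecasts `p`. -/
def mass (p : Situation → unitInterval) : Situation → ℝ
  | [] => 1
  | b :: s => coin p [] b * mass (shift p [b]) s

theorem coin_nonneg (p : Situation → unitInterval) (s : Situation) (b : Bool) : 0 ≤ coin p s b := by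
  have := (p s).2.1
  have := (p s).2.2
  cases b <;> simpa [coin]

theorem coin_le_one (p : Situation → unitInterval) (s : Situation) (b : Bool) : coin p s b ≤ 1 := by
  have := (p s).2.1
  have := (p s).2.2
  cases b <;> simpa [coin]

/-- The recursion of `mass` peels off the first outcome, which suits conditioning; this version
peels off the last one, which suits step-by-step arguments. -/
theorem mass_append (p : Situation → unitInterval) (s : Situation) (b : Bool) :
    mass p (s ++ [b]) = mass p s * coin p s b := by
  induction s generalizing p with
  | nil => simp [mass]
  | cons a s ih =>
    simp only [List.cons_append, mass, ih, mul_assoc]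
    rfl

theorem mass_nonneg (p : Situation → unitInterval) (s : Situation) : 0 ≤ mass p s := by
  induction s using List.reverseRecOn with
  | nil => simp [mass]
  | append_singleton s b ih => rw [mass_append]; exact mul_nonneg ih (coin_nonneg _ _ _)

theorem mass_le_one (p : Situation → unitInterval) (s : Situation) : mass p s ≤ 1 := by
  induction s using List.reverseRecOn with
  | nil => simp [mass]
  | append_singleton s b ih =>
    rw [mass_append]
    exact mul_le_one₀ ih (coin_nonneg _ _ _) (coin_le_one _ _ _)

theorem mass_initSeg (p : Situation → unitInterval) (ω : Path) (n : ℕ) :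
    mass p (initSeg ω n) = ∏ k ∈ Finset.range n, coin p (initSeg ω k) (ω k) := by
  induction n with
  | zero => simp [initSeg_zero, mass]
  | succ n ih => rw [initSeg_succ, mass_append, ih, Finset.prod_range_succ]

/-- The initial segments of the path that thresholds the numbers `u n` at the forecasts. -/
def thresholdSeg (p : Situation → unitInterval) (u : ℕ → unitInterval) : ℕ → Situation
  | 0 => []
  | n + 1 => thresholdSeg p u n ++ [decide (u n < p (thresholdSeg p u n))]

/-- The path that thresholds the numbers `u n` at the forecasts. -/
def thresholdPath (p : Situation → unitInterval) (u : ℕ → unitInterval) : Path :=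
  fun n => decide (u n < p (thresholdSeg p u n))

theorem initSeg_thresholdPath (p : Situation → unitInterval) (u : ℕ → unitInterval) (n : ℕ) :
    initSeg (thresholdPath p u) n = thresholdSeg p u n := by
  induction n with
  | zero => rfl
  | succ n ih => rw [initSeg_succ, ih, thresholdPath, thresholdSeg]

/-- The numbers that make the threshold equal to `b` in the situation `s`. -/
def thresholdSet (p : Situation → unitInterval) (s : Situation) (b : Bool) : Set unitInterval :=
  {x | decide (x < p s) = b}

theorem thresholdSet_false (p : Situation → unitInterval) (s : Situation) :
    thresholdSet p s false = Set.Ici (p s) := by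
  ext; simp [thresholdSet]

theorem thresholdSet_true (p : Situation → unitInterval) (s : Situation) :
    thresholdSet p s true = Set.Iio (p s) := by
  ext; simp [thresholdSet]

theorem measurableSet_thresholdSet (p : Situation → unitInterval) (s : Situation) (b : Bool) :
    MeasurableSet (thresholdSet p s b) := by
  cases b
  · rw [thresholdSet_false]; exact measurableSet_Ici
  · rw [thresholdSet_true]; exact measurableSet_Iio

theorem volume_thresholdSet (p : Situation → unitInterval) (s : Situation) (b : Bool) :
    volume (thresholdSet p s b) = ENNReal.ofReal (coin p s b) := by
  cases b
  · simp [thresholdSet_false, coin]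
  · simp [thresholdSet_true, coin]

/-- Once the target path `ω` is fixed, the thresholds along it no longer depend on `u`. The event
becomes a box of independent constraints, whose probability is a product. -/
theorem thresholdPath_preimage (p : Situation → unitInterval) (ω : Path) (n : ℕ) :
    thresholdPath p ⁻¹' cylinderSet (initSeg ω n) =
      Set.pi (Finset.range n) fun k => thresholdSet p (initSeg ω k) (ω k) := by
  ext u
  simp only [Set.mem_preimage, mem_cylinderSet, length_initSeg, Set.mem_pi, Finset.coe_range,
    Set.mem_Iio, thresholdSet, Set.mem_ofPred_eq]
  induction n with
  | zero => simp [initSeg_zero]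
  | succ n ih =>
    rw [initSeg_succ, initSeg_succ, Nat.forall_lt_succ_right, ← ih,
      ← initSeg_succ, ← initSeg_succ, initSeg_eq_iff, Nat.forall_lt_succ_right, ← initSeg_eq_iff]
    refine and_congr_right fun h => ?_
    rw [thresholdPath, ← initSeg_thresholdPath, h]

theorem measurable_thresholdPath (p : Situation → unitInterval) :
    Measurable (thresholdPath p) := by
  have h : ∀ t ∈ Set.range cylinderSet, MeasurableSet (thresholdPath p ⁻¹' t) := by
    rintro _ ⟨s, rfl⟩
    obtain ⟨ω, hω⟩ := exists_initSeg_eq s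
    rw [← hω, thresholdPath_preimage]
    exact MeasurableSet.pi (Set.to_countable _) fun k _ => measurableSet_thresholdSet _ _ _
  intro t ht
  exact measurable_generateFrom h (generateFrom_cylinderSet ▸ ht)

/-- The probability measure of the precise forecasts `p`. -/
def pathMeasure (p : Situation → unitInterval) : ProbabilityMeasure Path :=
  ⟨(Measure.infinitePi fun _ : ℕ => (volume : Measure unitInterval)).map (thresholdPath p),
    Measure.isProbabilityMeasure_map (measurable_thresholdPath p).aemeasurable⟩

theorem pathMeasure_cylinderSet (p : Situation → unitInterval) (s : Situation) :
    (pathMeasure p : Measure Path) (cylinderSet s) = ENNReal.ofReal (mass p s) := by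
  obtain ⟨ω, hω⟩ := exists_initSeg_eq s
  change (Measure.map _ _) _ = _
  rw [Measure.map_apply (measurable_thresholdPath p) (measurableSet_cylinderSet s), ← hω,
    thresholdPath_preimage, Measure.infinitePi_pi _ fun k _ => measurableSet_thresholdSet _ _ _,
    mass_initSeg, ENNReal.ofReal_prod_of_nonneg fun k _ => coin_nonneg _ _ _]
  simp [volume_thresholdSet]

theorem coe_pathMeasure_cylinderSet (p : Situation → unitInterval) (s : Situation) :
    (pathMeasure p (cylinderSet s) : ℝ) = mass p s := by
  have := pathMeasure_cylinderSet p s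
  change ((pathMeasure p : Measure Path) (cylinderSet s)).toNNReal.toReal = _
  rw [this]
  exact ENNReal.toReal_ofReal (mass_nonneg p s)

/-- Prefixing a path with an outcome. -/
def consPath (b : Bool) (ω : Path) : Path := fun n => Nat.casesOn n b ω

theorem initSeg_consPath (b : Bool) (ω : Path) (n : ℕ) :
    initSeg (consPath b ω) (n + 1) = b :: initSeg ω n := by
  simp [initSeg, List.range_succ_eq_map, consPath, Function.comp_def]

theorem measurable_consPath (b : Bool) : Measurable (consPath b) := by
  refine measurable_pi_lambda _ fun n => ?_
  cases n with
  | zero => exact measurable_const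
  | succ n => exact measurable_pi_apply n

theorem continuous_consPath (b : Bool) : Continuous (consPath b) := by
  refine continuous_pi fun n => ?_
  cases n with
  | zero => exact continuous_const
  | succ n => exact continuous_apply n

theorem consPath_preimage_cylinderSet (a b : Bool) (s : Situation) :
    consPath a ⁻¹' cylinderSet (b :: s) = if a = b then cylinderSet s else ∅ := by
  ext ω
  simp only [Set.mem_preimage, mem_cylinderSet, List.length_cons, initSeg_consPath, List.cons.injEq]
  split_ifs with h <;> simp [h, mem_cylinderSet]

/-- Conditioning on the first outcome. -/
theorem pathMeasure_eq (p : Situation → unitInterval) :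
    (pathMeasure p : Measure Path) =
      ENNReal.ofReal (p []) • (pathMeasure (shift p [true]) : Measure Path).map (consPath true) +
      ENNReal.ofReal (1 - p []) •
        (pathMeasure (shift p [false]) : Measure Path).map (consPath false) := by
  refine measure_ext_of_cylinderSet fun s => ?_
  have h0 : (0 : ℝ) ≤ p [] := (p []).2.1
  have h1 : (0 : ℝ) ≤ 1 - p [] := sub_nonneg.2 (p []).2.2
  simp only [Measure.coe_add, Measure.coe_smul, Pi.add_apply, Pi.smul_apply, smul_eq_mul]
  rw [Measure.map_apply (measurable_consPath _) (measurableSet_cylinderSet s),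
    Measure.map_apply (measurable_consPath _) (measurableSet_cylinderSet s)]
  cases s with
  | nil =>
    simp only [cylinderSet_nil, Set.preimage_univ, measure_univ, mul_one]
    rw [← ENNReal.ofReal_add h0 h1]
    simp
  | cons b s =>
    rw [consPath_preimage_cylinderSet, consPath_preimage_cylinderSet, pathMeasure_cylinderSet, mass,
      ENNReal.ofReal_mul (coin_nonneg _ _ _), ← pathMeasure_cylinderSet]
    cases b <;> simp [coin]

/-! ### Global expectations of precise forecasting systems -/

/-- The precise forecasting system with forecasts `p`. -/
def preciseSystem (p : Situation → unitInterval) : ForecastingSystem :=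
  fun s => NonemptyInterval.pure (p s)

theorem isPrecise_preciseSystem (p : Situation → unitInterval) : IsPrecise (preciseSystem p) := rfl

theorem IsPrecise.eq_preciseSystem {ψ : ForecastingSystem} (h : IsPrecise ψ) :
    ψ = preciseSystem fun s => (ψ s).fst := by
  funext s
  have : (ψ s).fst = (ψ s).snd := Subtype.ext (congrFun h s)
  exact NonemptyInterval.ext (Prod.ext rfl this.symm)

theorem localUpperExp_pure (x : unitInterval) (f : Bool → ℝ) :
    localUpperExp (NonemptyInterval.pure x) f = localExp x f := by
  simp [localUpperExp]

theorem isSupermartingale_preciseSystem {p : Situation → unitInterval} {M : Situation → ℝ} :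
    IsSupermartingale (preciseSystem p) M ↔
      ∀ s, localExp (p s) (fun x => M (s ++ [x])) ≤ M s := by
  simp [IsSupermartingale, preciseSystem, localUpperExp_pure]

/-- The local expectation of a precise forecast is affine and fixes constants. With
`limsup_le_indicator_iff`, this reduces lower probabilities to upper probabilities of complements.
-/
theorem isSupermartingale_one_sub {p : Situation → unitInterval} {M : Situation → ℝ} :
    IsSupermartingale (preciseSystem p) (fun s => 1 - M s) ↔
      IsSubmartingale (preciseSystem p) M := by
  simp only [IsSubmartingale, isSupermartingale_preciseSystem, localExp]
  refine forall_congr' fun s => ?_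
  constructor <;> intro h <;> nlinarith

/-- Real thresholds suffice because the reals are dense in the extended reals; afterwards only real
inequalities are handled. -/
theorem coe_le_liminf_iff {c : ℝ} {u : ℕ → ℝ} :
    (c : EReal) ≤ liminf (fun n => (u n : EReal)) atTop ↔ ∀ x < c, ∀ᶠ n in atTop, x < u n := by
  rw [le_liminf_iff]
  constructor
  · intro h x hx
    simpa using h x (by exact_mod_cast hx)
  · intro h y hy
    obtain ⟨x, hyx, hxc⟩ := EReal.lt_iff_exists_real_btwn.1 hy
    filter_upwards [h x (by exact_mod_cast hxc)] with n hn
    exact hyx.trans (by exact_mod_cast hn)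

theorem limsup_le_coe_iff {c : ℝ} {u : ℕ → ℝ} :
    limsup (fun n => (u n : EReal)) atTop ≤ (c : EReal) ↔ ∀ x > c, ∀ᶠ n in atTop, u n < x := by
  rw [limsup_le_iff]
  constructor
  · intro h x hx
    simpa using h x (by exact_mod_cast hx)
  · intro h y hy
    obtain ⟨x, hyx, hxc⟩ := EReal.lt_iff_exists_real_btwn.1 hy
    filter_upwards [h x (by exact_mod_cast hyx)] with n hn
    exact lt_trans (by exact_mod_cast hn) hxc

theorem limsup_le_indicator_iff {G : Set Path} {ω : Path} {u : ℕ → ℝ} :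
    limsup (fun n => (u n : EReal)) atTop ≤ ((G.indicator (fun _ => (1 : ℝ)) ω : ℝ) : EReal) ↔
      ((Gᶜ.indicator (fun _ => (1 : ℝ)) ω : ℝ) : EReal) ≤
        liminf (fun n => ((1 - u n : ℝ) : EReal)) atTop := by
  have h : Gᶜ.indicator (fun _ => (1 : ℝ)) ω = 1 - G.indicator (fun _ => (1 : ℝ)) ω := by
    by_cases hω : ω ∈ G <;> simp [hω]
  rw [coe_le_liminf_iff, limsup_le_coe_iff, h]
  constructor
  · intro H x hx
    filter_upwards [H (1 - x) (by linarith)] with n hn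
    linarith
  · intro H x hx
    filter_upwards [H (1 - x) (by linarith)] with n hn
    linarith

theorem exists_path_follow (c : Situation → Bool) : ∃ ω : Path, ∀ n, ω n = c (initSeg ω n) := by
  -- With forecasts in {0, 1} and all thresholded numbers equal to 0, the outcome is 1 exactly where
  -- the forecast is 1.
  refine ⟨thresholdPath (fun s => if c s then 1 else 0) fun _ => 0, fun n => ?_⟩
  rw [initSeg_thresholdPath, thresholdPath]
  cases c (thresholdSeg (fun s => if c s then 1 else 0) (fun _ => 0) n) <;> simp

theorem exists_child_le {p : Situation → unitInterval} {M : Situation → ℝ}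
    (hM : IsSupermartingale (preciseSystem p) M) (s : Situation) : ∃ b, M (s ++ [b]) ≤ M s := by
  by_contra! h
  have h1 := isSupermartingale_preciseSystem.1 hM s
  have h2 := h true
  have h3 := h false
  have h4 : (0 : ℝ) ≤ p s := (p s).2.1
  have h5 : (p s : ℝ) ≤ 1 := (p s).2.2
  simp only [localExp] at h1
  rcases h4.eq_or_lt with h6 | h6
  · rw [← h6] at h1
    linarith
  · nlinarith

/-- A supermartingale that is non-negative in the limit on all paths is non-negative. -/
theorem IsSupermartingale.nonneg {p : Situation → unitInterval} {M : Situation → ℝ}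
    (hM : IsSupermartingale (preciseSystem p) M)
    (h : ∀ ω, ((0 : ℝ) : EReal) ≤ liminf (fun n => (M (initSeg ω n) : EReal)) atTop)
    (s : Situation) : 0 ≤ M s := by
  by_contra! hs
  choose c hc using exists_child_le hM
  -- The path first reaches `s`, then always moves to a child where `M` does not increase, so `M`
  -- stays below the negative value `M s`.
  obtain ⟨ω, hω⟩ := exists_path_follow
    fun t => if t.length < s.length then s.getD t.length false else c t
  simp only [length_initSeg] at hω
  have h1 : initSeg ω s.length = s := by
    apply List.ext_getElem
    · simp
    · intro i h1 h2
      simp [initSeg, hω, h2]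
  have h2 : ∀ k, M (initSeg ω (s.length + k)) ≤ M s := by
    intro k
    induction k with
    | zero => rw [Nat.add_zero, h1]
    | succ k ih =>
      rw [← Nat.add_assoc, initSeg_succ, hω, if_neg (by omega)]
      exact (hc _).trans ih
  obtain ⟨n, hn1, hn2⟩ :=
    ((coe_le_liminf_iff.1 (h ω) (M s) hs).and (eventually_ge_atTop s.length)).exists
  obtain ⟨k, rfl⟩ := Nat.exists_eq_add_of_le hn2
  exact absurd (h2 k) (not_le.2 hn1)

/-! ### Supermartingales dominate the path measure -/

theorem measurable_comp_initSeg {β : Type*} [MeasurableSpace β] (g : Situation → β) (n : ℕ) :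
    Measurable fun ω : Path => g (initSeg ω n) := by
  intro A _
  have : (fun ω : Path => g (initSeg ω n)) ⁻¹' A =
      ⋃ s ∈ {s : Situation | g s ∈ A ∧ s.length = n}, cylinderSet s := by
    ext ω
    simp only [Set.mem_preimage, Set.mem_iUnion, Set.mem_ofPred_eq, mem_cylinderSet, exists_prop]
    constructor
    · exact fun h => ⟨_, ⟨h, by simp⟩, by simp⟩
    · rintro ⟨s, ⟨h, rfl⟩, h'⟩
      rwa [h']
  rw [this]
  exact MeasurableSet.biUnion (Set.to_countable _) fun s _ => measurableSet_cylinderSet s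

theorem shift_shift (p : Situation → unitInterval) (s t : Situation) :
    shift (shift p s) t = shift p (s ++ t) := by
  funext r
  simp [shift]

theorem shift_nil (p : Situation → unitInterval) : shift p [] = p := rfl

theorem shift_apply_nil (p : Situation → unitInterval) (s : Situation) : shift p s [] = p s := by
  simp [shift]

/-- Condition on the first outcome and apply the induction hypothesis at the two children; this is
why `s` must vary in the induction. -/
theorem lintegral_supermartingale_le {p : Situation → unitInterval} {M : Situation → ℝ}
    (hM : IsSupermartingale (preciseSystem p) M) (h0 : ∀ s, 0 ≤ M s) (n : ℕ) (s : Situation) :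
    ∫⁻ ω, ENNReal.ofReal (M (s ++ initSeg ω n)) ∂(pathMeasure (shift p s) : Measure Path) ≤
      ENNReal.ofReal (M s) := by
  induction n generalizing s with
  | zero => simp [initSeg_zero]
  | succ n ih =>
    have h4 : (0 : ℝ) ≤ p s := (p s).2.1
    have h5 : (0 : ℝ) ≤ 1 - p s := sub_nonneg.2 (p s).2.2
    have key : ∀ b, ∫⁻ ω, ENNReal.ofReal (M (s ++ initSeg ω (n + 1)))
        ∂(pathMeasure (shift (shift p s) [b]) : Measure Path).map (consPath b) ≤
          ENNReal.ofReal (M (s ++ [b])) := by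
      intro b
      rw [lintegral_map (measurable_comp_initSeg (fun t => ENNReal.ofReal (M (s ++ t))) _)
        (measurable_consPath b), shift_shift]
      refine le_trans (le_of_eq ?_) (ih (s ++ [b]))
      simp [initSeg_consPath]
    rw [pathMeasure_eq, lintegral_add_measure, lintegral_smul_measure, lintegral_smul_measure,
      shift_apply_nil]
    calc _ ≤ ENNReal.ofReal (p s) * ENNReal.ofReal (M (s ++ [true])) +
          ENNReal.ofReal (1 - p s) * ENNReal.ofReal (M (s ++ [false])) := by
          simp only [smul_eq_mul]
          gcongr
          · exact key true
          · exact key false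
      _ = ENNReal.ofReal (localExp (p s) fun x => M (s ++ [x])) := by
          rw [← ENNReal.ofReal_mul h4, ← ENNReal.ofReal_mul h5,
            ← ENNReal.ofReal_add (mul_nonneg h4 (h0 _)) (mul_nonneg h5 (h0 _)), localExp]
      _ ≤ _ := ENNReal.ofReal_le_ofReal (isSupermartingale_preciseSystem.1 hM s)

theorem pathMeasure_le_supermartingale {p : Situation → unitInterval} {M : Situation → ℝ}
    (hM : IsSupermartingale (preciseSystem p) M) {G : Set Path} (hG : MeasurableSet G)
    (h : ∀ ω, ((G.indicator (fun _ => (1 : ℝ)) ω : ℝ) : EReal) ≤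
      liminf (fun n => (M (initSeg ω n) : EReal)) atTop) :
    (pathMeasure p G : ℝ) ≤ M [] := by
  have h0 : ∀ s, 0 ≤ M s := hM.nonneg fun ω =>
    le_trans (by exact_mod_cast Set.indicator_nonneg (fun _ _ => zero_le_one) ω) (h ω)
  have hlim : ∀ ω, G.indicator 1 ω ≤ liminf (fun n => ENNReal.ofReal (M (initSeg ω n))) atTop := by
    intro ω
    by_cases hω : ω ∈ G
    · refine le_of_forall_lt fun c hc => ?_
      simp only [hω, Set.indicator_of_mem, Pi.one_apply] at hc
      -- An intermediate `d` below 1 is finite, so the hypothesis on the real limit inferior applies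
      -- to it.
      obtain ⟨d, hcd, hd⟩ := exists_between hc
      refine hcd.trans_le (le_liminf_of_le (by isBoundedDefault) ?_)
      have hd' : d.toReal < 1 := by
        simpa using (ENNReal.toReal_lt_toReal (ne_top_of_lt hd) ENNReal.one_ne_top).2 hd
      have := coe_le_liminf_iff.1 (h ω) d.toReal (by simpa [hω] using hd')
      filter_upwards [this] with n hn
      rw [← ENNReal.ofReal_toReal (ne_top_of_lt hd)]
      exact ENNReal.ofReal_le_ofReal hn.le
    · simp [hω]
  have : (pathMeasure p : Measure Path) G ≤ ENNReal.ofReal (M []) := by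
    calc (pathMeasure p : Measure Path) G
        = ∫⁻ ω, G.indicator 1 ω ∂(pathMeasure p : Measure Path) := (lintegral_indicator_one hG).symm
      _ ≤ ∫⁻ ω, liminf (fun n => ENNReal.ofReal (M (initSeg ω n))) atTop
            ∂(pathMeasure p : Measure Path) := lintegral_mono hlim
      _ ≤ liminf (fun n => ∫⁻ ω, ENNReal.ofReal (M (initSeg ω n))
            ∂(pathMeasure p : Measure Path)) atTop :=
          lintegral_liminf_le fun n => measurable_comp_initSeg (fun t => ENNReal.ofReal (M t)) n
      _ ≤ liminf (fun _ : ℕ => ENNReal.ofReal (M [])) atTop :=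
          liminf_le_liminf (Eventually.of_forall fun n => by
            simpa [shift_nil] using lintegral_supermartingale_le hM h0 n [])
      _ = _ := by simp
  exact ENNReal.toReal_le_of_le_ofReal (h0 []) this

/-- Prefixing a path with a situation. -/
def appendPath (s : Situation) (ω : Path) : Path := s.foldr consPath ω

theorem appendPath_append_singleton (s : Situation) (b : Bool) (ω : Path) :
    appendPath (s ++ [b]) ω = appendPath s (consPath b ω) := by
  simp [appendPath]

theorem continuous_appendPath (s : Situation) : Continuous (appendPath s) := by
  induction s with
  | nil => exact continuous_id
  | cons b s ih => exact (continuous_consPath b).comp ih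

theorem initSeg_appendPath (s : Situation) (ω : Path) : initSeg (appendPath s ω) s.length = s := by
  induction s with
  | nil => rfl
  | cons b s ih =>
    change initSeg (consPath b (appendPath s ω)) (s.length + 1) = _
    rw [initSeg_consPath, ih]

/-- The conditional probabilities of an event, for the precise forecasts `p`. -/
def condProb (p : Situation → unitInterval) (U : Set Path) (s : Situation) : ℝ :=
  pathMeasure (shift p s) (appendPath s ⁻¹' U)

/-- This is the law of total probability: `pathMeasure_eq` for the shifted forecasts, evaluated at
the event seen from `s`. -/
theorem localExp_condProb (p : Situation → unitInterval) {U : Set Path} (hU : MeasurableSet U)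
    (s : Situation) : localExp (p s) (fun x => condProb p U (s ++ [x])) = condProb p U s := by
  have hm := (continuous_appendPath s).measurable hU
  have h4 : (0 : ℝ) ≤ p s := (p s).2.1
  have h5 : (0 : ℝ) ≤ 1 - p s := sub_nonneg.2 (p s).2.2
  have hpre : ∀ b, consPath b ⁻¹' (appendPath s ⁻¹' U) = appendPath (s ++ [b]) ⁻¹' U := by
    intro b
    ext ω
    simp [appendPath_append_singleton]
  have h := congrArg (fun ν : Measure Path => (ν (appendPath s ⁻¹' U)).toReal)
    (pathMeasure_eq (shift p s))
  simp only [Measure.coe_add, Measure.coe_smul, Pi.add_apply, Pi.smul_apply, smul_eq_mul,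
    Measure.map_apply (measurable_consPath _) hm, hpre, shift_apply_nil, shift_shift] at h
  rw [ENNReal.toReal_add (by finiteness) (by finiteness), ENNReal.toReal_mul, ENNReal.toReal_mul,
    ENNReal.toReal_ofReal h4, ENNReal.toReal_ofReal h5] at h
  exact h.symm

theorem exists_initSeg_subset {U : Set Path} (hU : IsOpen U) {ω : Path} (hω : ω ∈ U) :
    ∃ n, ∀ ω', initSeg ω' n = initSeg ω n → ω' ∈ U := by
  obtain ⟨_, ⟨x, n, rfl⟩, hx, hsub⟩ :=
    (PiNat.isTopologicalBasis_cylinders (fun _ : ℕ => Bool)).exists_subset_of_mem_open hω hU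
  refine ⟨n, fun ω' h => hsub ?_⟩
  rw [initSeg_eq_iff] at h
  intro i hi
  rw [h i hi]
  exact hx i hi

theorem exists_supermartingale_lt (p : Situation → unitInterval) (G : Set Path) {ε : ℝ}
    (hε : 0 < ε) : ∃ M, IsSupermartingale (preciseSystem p) M ∧
      (∀ ω, ((G.indicator (fun _ => (1 : ℝ)) ω : ℝ) : EReal) ≤
        liminf (fun n => (M (initSeg ω n) : EReal)) atTop) ∧ M [] < pathMeasure p G + ε := by
  obtain ⟨U, hGU, hU, hlt⟩ := G.exists_isOpen_lt_add (μ := (pathMeasure p : Measure Path))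
    (measure_ne_top _ _) (ε := ENNReal.ofReal ε) (by simpa using hε)
  refine ⟨condProb p U, ?_, ?_, ?_⟩
  · exact isSupermartingale_preciseSystem.2 fun s => (localExp_condProb p hU.measurableSet s).le
  · intro ω
    rw [coe_le_liminf_iff]
    intro x hx
    by_cases hω : ω ∈ U
    -- An open set contains a whole cylinder around `ω`, so the conditional probability is exactly 1
    -- from time `n` on.
    · obtain ⟨n, hn⟩ := exists_initSeg_subset hU hω
      filter_upwards [eventually_ge_atTop n] with m hm
      have : appendPath (initSeg ω m) ⁻¹' U = Set.univ := by
        refine Set.eq_univ_of_forall fun ω' => hn _ ?_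
        have := initSeg_appendPath (initSeg ω m) ω'
        rw [length_initSeg, initSeg_eq_iff] at this
        rw [initSeg_eq_iff]
        exact fun k hk => this k (by omega)
      rw [condProb, this]
      refine hx.trans_le (le_trans (Set.indicator_le_self' (fun _ _ => zero_le_one) ω) ?_)
      simp
    · rw [Set.indicator_of_notMem fun h => hω (hGU h)] at hx
      exact Eventually.of_forall fun n => hx.trans_le NNReal.zero_le_coe
  · have := (ENNReal.toReal_lt_toReal (by finiteness) (by finiteness)).2 hlt
    rw [ENNReal.toReal_add (by finiteness) (by finiteness), ENNReal.toReal_ofReal hε.le] at this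
    exact this

theorem upperProb_preciseSystem (p : Situation → unitInterval) {G : Set Path}
    (hG : MeasurableSet G) : upperProb (preciseSystem p) G = pathMeasure p G := by
  have hlb : ∀ x ∈ {x : ℝ | ∃ M, IsSupermartingale (preciseSystem p) M ∧
      (∀ ω, ((G.indicator (fun _ => (1 : ℝ)) ω : ℝ) : EReal) ≤
        liminf (fun n => (M (initSeg ω n) : EReal)) atTop) ∧ x = M []}, pathMeasure p G ≤ x := by
    rintro _ ⟨M, hM, h, rfl⟩
    exact pathMeasure_le_supermartingale hM hG h
  apply le_antisymm
  · refine le_of_forall_pos_le_add fun ε hε => ?_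
    obtain ⟨M, hM, h, hlt⟩ := exists_supermartingale_lt p G hε
    exact (csInf_le ⟨_, hlb⟩ ⟨M, hM, h, rfl⟩).trans hlt.le
  · obtain ⟨M, hM, h, -⟩ := exists_supermartingale_lt p G one_pos
    exact le_csInf ⟨_, M, hM, h, rfl⟩ hlb

theorem coe_pathMeasure_compl (p : Situation → unitInterval) {G : Set Path}
    (hG : MeasurableSet G) : (pathMeasure p Gᶜ : ℝ) = 1 - pathMeasure p G :=
  probReal_compl_eq_one_sub (μ := (pathMeasure p : Measure Path)) hG

theorem lowerProb_preciseSystem (p : Situation → unitInterval) {G : Set Path}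
    (hG : MeasurableSet G) : lowerProb (preciseSystem p) G = pathMeasure p G := by
  have hub : ∀ x ∈ {x : ℝ | ∃ M, IsSubmartingale (preciseSystem p) M ∧
      (∀ ω, limsup (fun n => (M (initSeg ω n) : EReal)) atTop ≤
        ((G.indicator (fun _ => (1 : ℝ)) ω : ℝ) : EReal)) ∧ x = M []}, x ≤ pathMeasure p G := by
    rintro _ ⟨M, hM, h, rfl⟩
    have := pathMeasure_le_supermartingale (isSupermartingale_one_sub.2 hM) hG.compl
      fun ω => limsup_le_indicator_iff.1 (h ω)
    rw [coe_pathMeasure_compl p hG] at this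
    linarith
  have hex : ∀ ε > 0, ∃ M, IsSubmartingale (preciseSystem p) M ∧
      (∀ ω, limsup (fun n => (M (initSeg ω n) : EReal)) atTop ≤
        ((G.indicator (fun _ => (1 : ℝ)) ω : ℝ) : EReal)) ∧ pathMeasure p G - ε < M [] := by
    intro ε hε
    obtain ⟨M, hM, h, hlt⟩ := exists_supermartingale_lt p Gᶜ hε
    refine ⟨fun s => 1 - M s, ?_, fun ω => ?_, ?_⟩
    · rw [← isSupermartingale_one_sub]
      simpa using hM
    · rw [limsup_le_indicator_iff]
      simpa using h ω
    · rw [coe_pathMeasure_compl p hG] at hlt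
      linarith
  apply le_antisymm
  · obtain ⟨M, hM, h, -⟩ := hex 1 one_pos
    exact csSup_le ⟨_, M, hM, h, rfl⟩ hub
  · refine le_of_forall_pos_le_add fun ε hε => ?_
    obtain ⟨M, hM, h, hlt⟩ := hex ε hε
    have : M [] ≤ lowerProb (preciseSystem p) G := le_csSup ⟨_, hub⟩ ⟨M, hM, h, rfl⟩
    linarith

theorem generates_pathMeasure (p : Situation → unitInterval) :
    Generates (preciseSystem p) (pathMeasure p) :=
  fun _ hG => ⟨lowerProb_preciseSystem p hG, upperProb_preciseSystem p hG⟩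

theorem Generates.unique {ψ : ForecastingSystem} {μ ν : ProbabilityMeasure Path}
    (hμ : Generates ψ μ) (hν : Generates ψ ν) : μ = ν := by
  refine Subtype.ext (Measure.ext fun G hG => ?_)
  have h : (μ G : ℝ) = ν G := (hμ G hG).1.symm.trans (hν G hG).1
  exact (ENNReal.toReal_eq_toReal_iff' (measure_ne_top (μ : Measure Path) G)
    (measure_ne_top (ν : Measure Path) G)).1 h

theorem IsPrecise.existsUnique_generates {ψ : ForecastingSystem} (h : IsPrecise ψ) :
    ∃! μ, Generates ψ μ := by
  rw [h.eq_preciseSystem]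
  exact ⟨_, generates_pathMeasure _, fun ν hν => hν.unique (generates_pathMeasure _)⟩

/-! ### Primitive recursive predicates and approximations -/

section Primrec

variable {α β : Type} [Primcodable α] [Primcodable β]

/-- Unbounded search for a witness halts exactly when one exists. Both enumerability claims are
brought to this form. -/
theorem rePred_exists_nat {R : α → ℕ → Prop} (hR : PrimrecRel R) : REPred fun a => ∃ n, R a n := by
  classical
  have h : Partrec fun a => Nat.rfind (fun n => (Part.some (decide (R a n)) : Part Bool)) :=
    Partrec.rfind (p := fun a n => (Part.some (decide (R a n)) : Part Bool)) hR.decide.to_comp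
  refine h.dom_re.of_eq fun a => ?_
  refine Nat.rfind_dom.trans (exists_congr fun n => ?_)
  refine (and_iff_left fun {m} _ => trivial).trans ?_
  exact Part.mem_some_iff.trans (by simp)

theorem primrecPred_exists_mem {f : α → List β} {R : α → β → Prop} (hf : Primrec f)
    (hR : PrimrecRel R) : PrimrecPred fun a => ∃ b ∈ f a, R a b :=
  (PrimrecRel.exists_mem_list (R := fun b a => R a b) (hR.comp Primrec.snd Primrec.fst)).comp
    hf Primrec.id

theorem primrecPred_forall_mem {f : α → List β} {R : α → β → Prop} (hf : Primrec f)
    (hR : PrimrecRel R) : PrimrecPred fun a => ∀ b ∈ f a, R a b :=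
  (PrimrecRel.forall_mem_list (R := fun b a => R a b) (hR.comp Primrec.snd Primrec.fst)).comp
    hf Primrec.id

theorem primrec₂_pow : Primrec₂ fun a b : ℕ => a ^ b := by
  have h : Primrec fun x : ℕ × ℕ => Nat.rec (motive := fun _ => ℕ) 1 (fun _ IH => IH * x.1) x.2 :=
    Primrec.nat_rec' (h := fun (x : ℕ × ℕ) (y : ℕ × ℕ) => y.2 * x.1) Primrec.snd (Primrec.const 1)
      (Primrec.nat_mul.comp (Primrec.snd.comp Primrec.snd) (Primrec.fst.comp Primrec.fst))
  refine h.of_eq fun x => ?_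
  induction x.2 with
  | zero => simp
  | succ n ih => simp only [ih, pow_succ]

/-- The sum of two codes of rational numbers. -/
def addCode (c d : RatCode) : RatCode :=
  (c.1 * (d.2.2 + 1) + d.1 * (c.2.2 + 1), c.2.1 * (d.2.2 + 1) + d.2.1 * (c.2.2 + 1),
    c.2.2 * d.2.2 + c.2.2 + d.2.2)

/-- The product of two codes of rational numbers. -/
def mulCode (c d : RatCode) : RatCode :=
  (c.1 * d.1 + c.2.1 * d.2.1, c.1 * d.2.1 + c.2.1 * d.1, c.2.2 * d.2.2 + c.2.2 + d.2.2)

/-- The opposite of a code of a rational number. -/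
def negCode (c : RatCode) : RatCode := (c.2.1, c.1, c.2.2)

theorem decodeRat_addCode (c d : RatCode) :
    decodeRat (addCode c d) = decodeRat c + decodeRat d := by
  have h1 : (c.2.2 : ℚ) + 1 ≠ 0 := by positivity
  have h2 : (d.2.2 : ℚ) + 1 ≠ 0 := by positivity
  have h3 : (c.2.2 : ℚ) * d.2.2 + c.2.2 + d.2.2 + 1 ≠ 0 := by positivity
  simp only [decodeRat, addCode]
  push_cast
  field_simp
  ring

theorem decodeRat_mulCode (c d : RatCode) :
    decodeRat (mulCode c d) = decodeRat c * decodeRat d := by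
  have h1 : (c.2.2 : ℚ) + 1 ≠ 0 := by positivity
  have h2 : (d.2.2 : ℚ) + 1 ≠ 0 := by positivity
  have h3 : (c.2.2 : ℚ) * d.2.2 + c.2.2 + d.2.2 + 1 ≠ 0 := by positivity
  simp only [decodeRat, mulCode]
  push_cast
  field_simp
  ring

theorem decodeRat_negCode (c : RatCode) : decodeRat (negCode c) = -decodeRat c := by
  simp only [decodeRat, negCode]
  ring

theorem primrec₂_addCode : Primrec₂ addCode := by
  unfold Primrec₂ addCode
  have c1 : Primrec fun p : RatCode × RatCode => p.1.1 := Primrec.fst.comp Primrec.fst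
  have c2 : Primrec fun p : RatCode × RatCode => p.1.2.1 :=
    Primrec.fst.comp (Primrec.snd.comp Primrec.fst)
  have c3 : Primrec fun p : RatCode × RatCode => p.1.2.2 :=
    Primrec.snd.comp (Primrec.snd.comp Primrec.fst)
  have d1 : Primrec fun p : RatCode × RatCode => p.2.1 := Primrec.fst.comp Primrec.snd
  have d2 : Primrec fun p : RatCode × RatCode => p.2.2.1 :=
    Primrec.fst.comp (Primrec.snd.comp Primrec.snd)
  have d3 : Primrec fun p : RatCode × RatCode => p.2.2.2 :=
    Primrec.snd.comp (Primrec.snd.comp Primrec.snd)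
  have mul := @Primrec.nat_mul
  have add := @Primrec.nat_add
  exact (add.comp (mul.comp c1 (Primrec.succ.comp d3)) (mul.comp d1 (Primrec.succ.comp c3))).pair
    ((add.comp (mul.comp c2 (Primrec.succ.comp d3)) (mul.comp d2 (Primrec.succ.comp c3))).pair
      (add.comp (add.comp (mul.comp c3 d3) c3) d3))

theorem primrec₂_mulCode : Primrec₂ mulCode := by
  unfold Primrec₂ mulCode
  have c1 : Primrec fun p : RatCode × RatCode => p.1.1 := Primrec.fst.comp Primrec.fst
  have c2 : Primrec fun p : RatCode × RatCode => p.1.2.1 :=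
    Primrec.fst.comp (Primrec.snd.comp Primrec.fst)
  have c3 : Primrec fun p : RatCode × RatCode => p.1.2.2 :=
    Primrec.snd.comp (Primrec.snd.comp Primrec.fst)
  have d1 : Primrec fun p : RatCode × RatCode => p.2.1 := Primrec.fst.comp Primrec.snd
  have d2 : Primrec fun p : RatCode × RatCode => p.2.2.1 :=
    Primrec.fst.comp (Primrec.snd.comp Primrec.snd)
  have d3 : Primrec fun p : RatCode × RatCode => p.2.2.2 :=
    Primrec.snd.comp (Primrec.snd.comp Primrec.snd)
  have mul := @Primrec.nat_mul
  have add := @Primrec.nat_add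
  exact (add.comp (mul.comp c1 d1) (mul.comp c2 d2)).pair
    ((add.comp (mul.comp c1 d2) (mul.comp c2 d1)).pair (add.comp (add.comp (mul.comp c3 d3) c3) d3))

theorem primrec_negCode : Primrec negCode :=
  (Primrec.fst.comp Primrec.snd).pair
    (Primrec.fst.pair (Primrec.snd.comp Primrec.snd))

theorem primrecRel_decodeRat_lt : PrimrecRel fun c d => decodeRat c < decodeRat d := by
  have hpos : PrimrecPred fun c => 0 < decodeRat c :=
    (Primrec.nat_lt.comp (Primrec.fst.comp Primrec.snd) Primrec.fst).of_eq fun c => by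
      have h : (0 : ℚ) < (c.2.2 : ℚ) + 1 := by positivity
      rw [decodeRat, div_pos_iff_of_pos_right h, sub_pos, Nat.cast_lt]
  refine (PrimrecPred.comp (f := fun p : RatCode × RatCode => addCode p.2 (negCode p.1)) hpos
    (primrec₂_addCode.comp Primrec.snd (primrec_negCode.comp Primrec.fst))).of_eq fun p => ?_
  rw [decodeRat_addCode, decodeRat_negCode]
  constructor <;> intro h <;> linarith

theorem primrecRel_decodeRat_le : PrimrecRel fun c d => decodeRat c ≤ decodeRat d :=
  (primrecRel_decodeRat_lt.comp Primrec.snd Primrec.fst).not.of_eq fun _ => not_lt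

/-- Peel off the lowest digit `d 0` and apply induction to the shifted sequence. This lets one
natural number code a whole grid forecast. -/
theorem exists_digits {b : ℕ} {d : ℕ → ℕ} (hd : ∀ i, d i < b) (L : ℕ) :
    ∃ n < b ^ L, ∀ i < L, n / b ^ i % b = d i := by
  induction L generalizing d with
  | zero => exact ⟨0, by simp, by simp⟩
  | succ L ih =>
    obtain ⟨n, hn, h⟩ := ih fun i => hd (i + 1)
    have hb : 0 < b := (Nat.zero_le _).trans_lt (hd 0)
    refine ⟨d 0 + b * n, ?_, ?_⟩
    · have := hd 0
      calc d 0 + b * n < b + b * n := by omega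
        _ = b * (n + 1) := by ring
        _ ≤ b * b ^ L := Nat.mul_le_mul_left _ hn
        _ = b ^ (L + 1) := by ring
    · rintro (_ | i) hi
      · simp [Nat.mod_eq_of_lt (hd 0)]
      · rw [pow_succ', ← Nat.div_div_eq_div_mul, Nat.add_mul_div_left _ _ hb,
          Nat.div_eq_of_lt (hd 0), zero_add]
        exact h i (by omega)

/-- The result of a computable function after a bounded number of computation steps. -/
theorem exists_stages {σ : Type} [Primcodable σ] {f : α → σ} (hf : Computable f) :
    ∃ g : α → ℕ → Option σ, Primrec₂ g ∧ (∀ a k, g a k = none ∨ g a k = some (f a)) ∧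
      ∀ a, ∀ᶠ k in atTop, g a k = some (f a) := by
  obtain ⟨e, he⟩ := Nat.Partrec.Code.exists_code.1 hf
  have heval : ∀ a, e.eval (Encodable.encode a) = Part.some (Encodable.encode (f a)) := by
    intro a
    rw [he]
    simp
  refine ⟨fun a k => (e.evaln k (Encodable.encode a)).bind Encodable.decode, ?_, ?_, ?_⟩
  · refine Primrec.option_bind ?_ (Primrec.decode.comp Primrec.snd)
    exact Nat.Partrec.Code.primrec_evaln.comp
      ((Primrec.snd.pair (Primrec.const e)).pair (Primrec.encode.comp Primrec.fst))
  · intro a k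
    rcases h : e.evaln k (Encodable.encode a) with _ | y
    · exact Or.inl (by simp [h])
    · have := Nat.Partrec.Code.evaln_sound (Option.mem_def.2 h)
      rw [heval, Part.mem_some_iff] at this
      exact Or.inr (by simp [h, this])
  · intro a
    obtain ⟨k, hk⟩ := Nat.Partrec.Code.evaln_complete.1
      (show Encodable.encode (f a) ∈ e.eval (Encodable.encode a) by simp [heval])
    filter_upwards [eventually_ge_atTop k] with l hl
    have := Nat.Partrec.Code.evaln_mono hl hk
    rw [Option.mem_def] at this
    simp [this]

/-- A lower semicomputable map is the limit from below of a primitive recursive sequence. -/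
theorem LowerSemicomputable.exists_primrec {r : α → ℝ} (h : LowerSemicomputable r)
    (hr : ∀ a, -1 ≤ r a) :
    ∃ c : α → ℕ → RatCode, Primrec₂ c ∧ (∀ a n, (decodeRat (c a n) : ℝ) ≤ r a) ∧
      ∀ a, Tendsto (fun n => (decodeRat (c a n) : ℝ)) atTop (𝓝 (r a)) := by
  obtain ⟨q, ⟨f, hf, hfq⟩, hmono, hlim⟩ := h
  obtain ⟨g, hg, hg1, hg2⟩ := exists_stages hf
  have hmono' : ∀ a, Monotone fun n => q (a, n) := fun a => monotone_nat_of_le_succ (hmono a)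
  have hle : ∀ a n, (q (a, n) : ℝ) ≤ r a := fun a =>
    Monotone.ge_of_tendsto (fun i j hij => by exact_mod_cast hmono' a hij) (hlim a)
  -- Among the indices below `n`, keep the value at the last one whose computation halts within `k`
  -- steps. The initial code stands for -1, which is a lower bound of `r` by `hr`.
  let G : α → ℕ → ℕ → RatCode := fun a k n =>
    Nat.rec (motive := fun _ => RatCode) (0, 1, 0) (fun j IH => (g (a, j) k).getD IH) n
  have G0 : ∀ a k, G a k 0 = (0, 1, 0) := fun _ _ => rfl
  have Gs : ∀ a k n, G a k (n + 1) = (g (a, n) k).getD (G a k n) := fun _ _ _ => rfl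
  have hG1 : ∀ a k n, (decodeRat (G a k n) : ℝ) ≤ r a := by
    intro a k n
    induction n with
    | zero => simpa [G0, decodeRat] using hr a
    | succ n ih =>
      rw [Gs]
      rcases hg1 (a, n) k with h | h
      · simpa [h] using ih
      · simpa [h, hfq] using hle a n
  -- Later finished indices only improve the value, since `q` is non-decreasing.
  have hG2 : ∀ a k j, g (a, j) k = some (f (a, j)) → ∀ n, j < n →
      q (a, j) ≤ decodeRat (G a k n) := by
    intro a k j hj n hn
    induction n with
    | zero => omega
    | succ n ih =>
      rw [Gs]
      rcases hg1 (a, n) k with h | h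
      · have hjn : j ≠ n := by
          rintro rfl
          simp [h] at hj
        simpa [h] using ih (by omega)
      · simpa [h, hfq] using hmono' a (show j ≤ n by omega)
  refine ⟨fun a k => G a k k, ?_, fun a n => hG1 a n n, fun a => ?_⟩
  · refine Primrec.nat_rec' (f := fun x : α × ℕ => x.2) (g := fun _ => ((0, 1, 0) : RatCode))
      (h := fun x y => (g (x.1, y.1) x.2).getD y.2) Primrec.snd (Primrec.const _) ?_
    refine Primrec.option_getD.comp (hg.comp ?_ (Primrec.snd.comp Primrec.fst))
      (Primrec.snd.comp Primrec.snd)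
    exact (Primrec.fst.comp Primrec.fst).pair (Primrec.fst.comp Primrec.snd)
  · refine tendsto_order.2 ⟨fun x hx => ?_, fun x hx => ?_⟩
    · obtain ⟨j, hj⟩ := ((hlim a).eventually (lt_mem_nhds hx)).exists
      filter_upwards [hg2 (a, j), eventually_gt_atTop j] with k hk hjk
      exact hj.trans_le (by exact_mod_cast hG2 a k j hk k hjk)
    · exact Eventually.of_forall fun n => (hG1 a n n).trans_lt hx

end Primrec

/-! ### The class of compatible measures -/

/-- The precise forecasts that are compatible with a forecasting system. -/
def forecastBox (φ : ForecastingSystem) : Set (Situation → unitInterval) :=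
  Set.pi Set.univ fun s => Set.Icc (φ s).fst (φ s).snd

theorem mem_forecastBox {φ : ForecastingSystem} {p : Situation → unitInterval} :
    p ∈ forecastBox φ ↔ ∀ s, lowerBound φ s ≤ p s ∧ (p s : ℝ) ≤ upperBound φ s := by
  simp only [forecastBox, Set.mem_univ_pi, Set.mem_Icc]
  rfl

theorem isCompact_forecastBox (φ : ForecastingSystem) : IsCompact (forecastBox φ) :=
  isCompact_univ_pi fun _ => isCompact_Icc

theorem compatible_preciseSystem {φ : ForecastingSystem} {p : Situation → unitInterval} :
    Compatible (preciseSystem p) φ ↔ p ∈ forecastBox φ := by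
  simp [Compatible, preciseSystem, forecastBox, Set.mem_pi, ← NonemptyInterval.coe_def]

theorem compatibleMeasures_eq (φ : ForecastingSystem) :
    compatibleMeasures φ = pathMeasure '' forecastBox φ := by
  ext μ
  constructor
  · rintro ⟨ψ, h1, h2, h3⟩
    rw [h1.eq_preciseSystem] at h2 h3
    exact ⟨_, compatible_preciseSystem.1 h2, (generates_pathMeasure _).unique h3⟩
  · rintro ⟨p, hp, rfl⟩
    exact ⟨_, isPrecise_preciseSystem p, compatible_preciseSystem.2 hp, generates_pathMeasure p⟩

theorem coe_cylinderSet_append_add (μ : ProbabilityMeasure Path) (s : Situation) :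
    (μ (cylinderSet (s ++ [true])) : ℝ) + μ (cylinderSet (s ++ [false])) = μ (cylinderSet s) := by
  have h := measureReal_inter_add_sdiff (μ := (μ : Measure Path)) (s := cylinderSet s)
    (t := {ω | ω s.length = true})
    ((measurable_pi_apply (X := fun _ => Bool) s.length) (measurableSet_singleton true))
  have h2 : cylinderSet s \ {ω | ω s.length = true} = cylinderSet (s ++ [false]) := by
    rw [cylinderSet_append]
    ext ω
    simp
  rw [← cylinderSet_append, h2] at h
  exact h

/-- The compatible measures are characterised by linear constraints on the probabilities of the
cylinder sets. -/
theorem mem_compatibleMeasures_iff {φ : ForecastingSystem} {μ : ProbabilityMeasure Path} :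
    μ ∈ compatibleMeasures φ ↔ ∀ s,
      lowerBound φ s * μ (cylinderSet s) ≤ μ (cylinderSet (s ++ [true])) ∧
        (μ (cylinderSet (s ++ [true])) : ℝ) ≤ upperBound φ s * μ (cylinderSet s) := by
  rw [compatibleMeasures_eq]
  constructor
  · rintro ⟨p, hp, rfl⟩ s
    rw [mem_forecastBox] at hp
    rw [coe_pathMeasure_cylinderSet, coe_pathMeasure_cylinderSet, mass_append, mul_comm (mass p s)]
    simp only [coin, if_true]
    exact ⟨mul_le_mul_of_nonneg_right (hp s).1 (mass_nonneg p s),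
      mul_le_mul_of_nonneg_right (hp s).2 (mass_nonneg p s)⟩
  · intro h
    have hadd := coe_cylinderSet_append_add μ
    have hp : ∀ s, ∃ x : unitInterval, (lowerBound φ s ≤ x ∧ (x : ℝ) ≤ upperBound φ s) ∧
        (μ (cylinderSet (s ++ [true])) : ℝ) = μ (cylinderSet s) * x := by
      intro s
      have h0 : (0 : ℝ) ≤ μ (cylinderSet (s ++ [true])) := NNReal.zero_le_coe
      have h0' : (0 : ℝ) ≤ μ (cylinderSet (s ++ [false])) := NNReal.zero_le_coe
      have hs : (0 : ℝ) ≤ μ (cylinderSet s) := NNReal.zero_le_coe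
      rcases hs.eq_or_lt with hs | hs
      -- On a null cylinder the conditional probability is undefined and any compatible forecast
      -- works, as the child is null too.
      · refine ⟨(φ s).fst, ⟨le_rfl, (φ s).fst_le_snd⟩, ?_⟩
        rw [← hs, zero_mul]
        linarith [hadd s]
      · refine ⟨⟨μ (cylinderSet (s ++ [true])) / μ (cylinderSet s), div_nonneg h0 hs.le,
          (div_le_one hs).2 (by linarith [hadd s])⟩, ⟨?_, ?_⟩, ?_⟩
        · exact (le_div_iff₀ hs).2 (h s).1
        · exact (div_le_iff₀ hs).2 (h s).2
        · exact (mul_div_cancel₀ _ hs.ne').symm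
    choose p hp hμ using hp
    refine ⟨p, mem_forecastBox.2 hp, Subtype.ext
      (measure_ext_of_cylinderSet (μ := (pathMeasure p : Measure Path)) fun s => ?_)⟩
    have key : ∀ s, (pathMeasure p (cylinderSet s) : ℝ) = μ (cylinderSet s) := by
      intro s
      rw [coe_pathMeasure_cylinderSet]
      induction s using List.reverseRecOn with
      | nil => simp [mass, cylinderSet_nil]
      | append_singleton s b ih =>
        rw [mass_append, ih]
        cases b
        · have h1 := hadd s
          have h2 := hμ s
          simp only [coin, Bool.false_eq_true, if_false]
          linarith
        · simp only [coin, if_true]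
          exact (hμ s).symm
    exact (ENNReal.toReal_eq_toReal_iff' (measure_ne_top _ _)
      (measure_ne_top (μ : Measure Path) _)).1 (key s)

/-! ### Effective closedness -/

theorem exists_mem_decodeGenerator {c : GeneratorCode} {P : ℚ × Situation × ℚ → Prop} :
    (∃ t ∈ decodeGenerator c, P t) ↔ ∃ x ∈ c, P (decodeRat x.1, x.2.1, decodeRat x.2.2) := by
  simp only [decodeGenerator, List.mem_toFinset, List.mem_map, exists_exists_and_eq_and]

theorem forall_mem_decodeGenerator {c : GeneratorCode} {P : ℚ × Situation × ℚ → Prop} :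
    (∀ t ∈ decodeGenerator c, P t) ↔ ∀ x ∈ c, P (decodeRat x.1, x.2.1, decodeRat x.2.2) := by
  simp only [decodeGenerator, List.mem_toFinset, List.forall_mem_map]

/-- The basic open conditions `t` and `t'` contradict the bounds `cl` (from below on the lower
forecast) and `cu` (from below on the opposite of the upper forecast). -/
def Refutes (cl cu : Situation → ℕ → RatCode) (m : ℕ) (t t' : ℚ × Situation × ℚ) : Prop :=
  t.2.1 = t'.2.1 ++ [true] ∧
    ((0 ≤ t'.1 ∧ t.2.2 ≤ decodeRat (cl t'.2.1 m) * t'.1) ∨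
      -decodeRat (cu t'.2.1 m) * t'.2.2 ≤ t.1)

theorem primrecPred_refutes {cl cu : Situation → ℕ → RatCode} (hcl : Primrec₂ cl)
    (hcu : Primrec₂ cu) :
    PrimrecPred fun a : ((GeneratorCode × ℕ) × RatCode × Situation × RatCode) ×
      RatCode × Situation × RatCode =>
        Refutes cl cu a.1.1.2 (decodeRat a.1.2.1, a.1.2.2.1, decodeRat a.1.2.2.2)
          (decodeRat a.2.1, a.2.2.1, decodeRat a.2.2.2) := by
  let A := ((GeneratorCode × ℕ) × RatCode × Situation × RatCode) × RatCode × Situation × RatCode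
  have hm : Primrec fun a : A => a.1.1.2 := Primrec.snd.comp (Primrec.fst.comp Primrec.fst)
  have hx : Primrec fun a : A => a.1.2 := Primrec.snd.comp Primrec.fst
  have hy : Primrec fun a : A => a.2 := Primrec.snd
  have hx1 : Primrec fun a : A => a.1.2.1 := Primrec.fst.comp hx
  have hx2 : Primrec fun a : A => a.1.2.2.1 := Primrec.fst.comp (Primrec.snd.comp hx)
  have hx3 : Primrec fun a : A => a.1.2.2.2 := Primrec.snd.comp (Primrec.snd.comp hx)
  have hy1 : Primrec fun a : A => a.2.1 := Primrec.fst.comp hy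
  have hy2 : Primrec fun a : A => a.2.2.1 := Primrec.fst.comp (Primrec.snd.comp hy)
  have hy3 : Primrec fun a : A => a.2.2.2 := Primrec.snd.comp (Primrec.snd.comp hy)
  refine PrimrecPred.of_eq (PrimrecPred.and
    (Primrec.eq.comp hx2 (Primrec.list_concat.comp hy2 (Primrec.const true)))
    (PrimrecPred.or (PrimrecPred.and
      (primrecRel_decodeRat_le.comp (Primrec.const ((0, 0, 0) : RatCode)) hy1)
      (primrecRel_decodeRat_le.comp hx3 (primrec₂_mulCode.comp (hcl.comp hy2 hm) hy1)))
      (primrecRel_decodeRat_le.comp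
        (primrec₂_mulCode.comp (primrec_negCode.comp (hcu.comp hy2 hm)) hy3) hx1))) fun a => ?_
  have h0 : decodeRat (0, 0, 0) = 0 := by simp [decodeRat]
  simp only [Refutes, decodeRat_mulCode, decodeRat_negCode, h0]

theorem effectivelyClosed_compatibleMeasures {φ : ForecastingSystem}
    (hlower : LowerSemicomputable (lowerBound φ)) (hupper : UpperSemicomputable (upperBound φ)) :
    EffectivelyClosed (compatibleMeasures φ) := by
  obtain ⟨cl, hcl, hcl_le, hcl_lim⟩ := hlower.exists_primrec fun s => by
    have := (φ s).fst.2.1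
    exact (by norm_num : (-1 : ℝ) ≤ 0).trans this
  obtain ⟨cu, hcu, hcu_le, hcu_lim⟩ := LowerSemicomputable.exists_primrec hupper fun s => by
    have := (φ s).snd.2.2
    exact neg_le_neg this
  refine ⟨{b | ∃ m, ∃ t ∈ b, ∃ t' ∈ b, Refutes cl cu m t t'}, ?_, ?_⟩
  · refine (rePred_exists_nat (R := fun (c : GeneratorCode) m => ∃ x ∈ c, ∃ y ∈ c,
      Refutes cl cu m (decodeRat x.1, x.2.1, decodeRat x.2.2)
        (decodeRat y.1, y.2.1, decodeRat y.2.2)) ?_).of_eq fun c => ?_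
    · refine primrecPred_exists_mem Primrec.fst ?_
      refine primrecPred_exists_mem (Primrec.fst.comp Primrec.fst) ?_
      exact primrecPred_refutes hcl hcu
    · simp only [Set.mem_ofPred_eq, exists_mem_decodeGenerator]
  · ext μ
    simp only [Set.mem_iUnion, Set.mem_ofPred_eq, Set.mem_compl_iff, mem_compatibleMeasures_iff,
      exists_prop]
    constructor
    · rintro ⟨b, ⟨m, ⟨u, s, v⟩, ht, ⟨u', s', v'⟩, ht', rfl, h⟩, hμ⟩ hall
      obtain ⟨h1, h2⟩ := hμ _ ht
      obtain ⟨h3, h4⟩ := hμ _ ht'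
      simp only at h h1 h2 h3 h4
      have hl := (hall s').1
      have hu := (hall s').2
      -- Either the child has too little mass, `μ(s'1) < v ≤ cl u' ≤ lower · μ(s')`, or too much,
      -- `upper · μ(s') ≤ -cu v' ≤ u < μ(s'1)`.
      rcases h with ⟨h5, h6⟩ | h5
      · have h5' : (0 : ℝ) ≤ u' := by exact_mod_cast h5
        have h6' : (v : ℝ) ≤ decodeRat (cl s' m) * u' := by exact_mod_cast h6
        have h7 : (decodeRat (cl s' m) : ℝ) * u' ≤ lowerBound φ s' * u' :=
          mul_le_mul_of_nonneg_right (hcl_le s' m) h5'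
        have h8 : lowerBound φ s' * u' ≤ lowerBound φ s' * μ (cylinderSet s') :=
          mul_le_mul_of_nonneg_left h3.le (φ s').fst.2.1
        linarith
      · have h5' : -(decodeRat (cu s' m) : ℝ) * v' ≤ u := by exact_mod_cast h5
        have h6 : upperBound φ s' ≤ -(decodeRat (cu s' m) : ℝ) := by linarith [hcu_le s' m]
        have h7 : (0 : ℝ) ≤ μ (cylinderSet s') := NNReal.zero_le_coe
        have h8 : upperBound φ s' * v' ≤ -(decodeRat (cu s' m) : ℝ) * v' :=
          mul_le_mul_of_nonneg_right h6 (h7.trans h4.le)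
        have h9 : upperBound φ s' * μ (cylinderSet s') ≤ upperBound φ s' * v' :=
          mul_le_mul_of_nonneg_left h4.le (φ s').snd.2.1
        linarith
    · intro h
      push Not at h
      obtain ⟨s, hs⟩ := h
      set y : ℝ := ((μ (cylinderSet s) : NNReal) : ℝ)
      set z : ℝ := ((μ (cylinderSet (s ++ [true])) : NNReal) : ℝ)
      have hy0 : 0 ≤ y := NNReal.zero_le_coe
      have hz0 : 0 ≤ z := NNReal.zero_le_coe
      have hy1 : y < 2 := lt_of_le_of_lt (b := 1) (by exact_mod_cast μ.apply_le_one _) one_lt_two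
      have hz1 : z < 2 := lt_of_le_of_lt (b := 1) (by exact_mod_cast μ.apply_le_one _) one_lt_two
      by_cases hlow : lowerBound φ s * y ≤ z
      · have hup := hs hlow
        obtain ⟨m, hm⟩ := (((hcu_lim s).neg.mul_const y).eventually
          (gt_mem_nhds (show - -upperBound φ s * y < z by simpa using hup))).exists
        -- Enlarging `y` slightly to a rational `v` keeps the strict violation, leaving room for a
        -- rational `u` below `z`.
        have hcont : Tendsto (fun x : ℝ => -(decodeRat (cu s m) : ℝ) * x) (𝓝[>] y)
            (𝓝 (-(decodeRat (cu s m) : ℝ) * y)) :=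
          ((continuous_const.mul continuous_id).tendsto y).mono_left nhdsWithin_le_nhds
        obtain ⟨x, hx1, hx2⟩ := ((hcont.eventually (gt_mem_nhds hm)).and
          self_mem_nhdsWithin).exists
        obtain ⟨v, hv1, hv2⟩ := exists_rat_btwn (show y < x from hx2)
        have hcu0 : 0 ≤ -(decodeRat (cu s m) : ℝ) := by
          have h1 : 0 ≤ upperBound φ s := (φ s).snd.2.1
          linarith [hcu_le s m]
        have hv3 : -(decodeRat (cu s m) : ℝ) * v < z :=
          (mul_le_mul_of_nonneg_left hv2.le hcu0).trans_lt hx1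
        obtain ⟨u, hu1, hu2⟩ := exists_rat_btwn hv3
        -- The bounds 2 and -1 are vacuous for probabilities; only `u` and `v` matter.
        refine ⟨{(u, s ++ [true], 2), (-1, s, v)}, ⟨m, (u, s ++ [true], 2), by simp, (-1, s, v),
          by simp, rfl, Or.inr ?_⟩, ?_⟩
        · exact_mod_cast hu1.le
        · intro t ht
          simp only [Finset.mem_insert, Finset.mem_singleton] at ht
          rcases ht with rfl | rfl
          · exact ⟨hu2, by simpa using hz1⟩
          · exact ⟨by push_cast; linarith, hv1⟩
      · rw [not_le] at hlow
        obtain ⟨m, hm⟩ := (((hcl_lim s).mul_const y).eventually (lt_mem_nhds hlow)).exists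
        -- A lower-bound violation forces positive mass at `s`, so the rational `u` can be chosen
        -- positive, as `Refutes` needs.
        have hypos : 0 < y := by
          rcases hy0.eq_or_lt with h0 | h0
          · rw [← h0, mul_zero] at hlow
            exact absurd hlow (not_lt.2 hz0)
          · exact h0
        have hcont : Tendsto (fun x : ℝ => (decodeRat (cl s m) : ℝ) * x) (𝓝[<] y)
            (𝓝 ((decodeRat (cl s m) : ℝ) * y)) :=
          ((continuous_const.mul continuous_id).tendsto y).mono_left nhdsWithin_le_nhds
        obtain ⟨x, ⟨hx1, hx2⟩, hx3⟩ := (((hcont.eventually (lt_mem_nhds hm)).and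
          self_mem_nhdsWithin).and (mem_nhdsWithin_of_mem_nhds (lt_mem_nhds hypos))).exists
        obtain ⟨u, hu1, hu2⟩ := exists_rat_btwn (show x < y from hx2)
        have hx0 : 0 < x := hx3
        have hcl0 : 0 ≤ (decodeRat (cl s m) : ℝ) := by
          by_contra! hneg
          linarith [mul_neg_of_neg_of_pos hneg hx0]
        have hu3 : z < (decodeRat (cl s m) : ℝ) * u :=
          hx1.trans_le (mul_le_mul_of_nonneg_left hu1.le hcl0)
        obtain ⟨v, hv1, hv2⟩ := exists_rat_btwn hu3
        refine ⟨{(-1, s ++ [true], v), (u, s, 2)}, ⟨m, (-1, s ++ [true], v), by simp, (u, s, 2),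
          by simp, rfl, Or.inl ⟨?_, ?_⟩⟩, ?_⟩
        · exact_mod_cast (hx0.trans hu1).le
        · exact_mod_cast hv2.le
        · intro t ht
          simp only [Finset.mem_insert, Finset.mem_singleton] at ht
          rcases ht with rfl | rfl
          · exact ⟨by push_cast; linarith, hv1⟩
          · exact ⟨hu2, by simpa using hy1⟩

/-! ### Effective compactness -/

theorem pathMeasure_mem_basicOpen {p : Situation → unitInterval} {c : GeneratorCode} :
    pathMeasure p ∈ basicOpen (decodeGenerator c) ↔ ∀ x ∈ c,
      (decodeRat x.1 : ℝ) < mass p x.2.1 ∧ mass p x.2.1 < (decodeRat x.2.2 : ℝ) := by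
  change (∀ t ∈ decodeGenerator c, _) ↔ _
  simp only [coe_pathMeasure_cylinderSet]
  exact forall_mem_decodeGenerator (P := fun t => (t.1 : ℝ) < mass p t.2.1 ∧ mass p t.2.1 < t.2.2)

/-! ### Compactness as a continuous image -/

theorem continuous_mass (s : Situation) :
    Continuous fun p : Situation → unitInterval => mass p s := by
  induction s using List.reverseRecOn with
  | nil => exact continuous_const
  | append_singleton s b ih =>
    simp only [mass_append]
    refine ih.mul ?_
    have h : Continuous fun p : Situation → unitInterval => (p s : ℝ) :=
      continuous_subtype_val.comp (continuous_apply s)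
    cases b
    · exact continuous_const.sub h
    · exact h

/-- A basic open condition constrains finitely many masses, each continuous in the forecasts. -/
theorem continuous_pathMeasure : @Continuous _ _ _ measureTopology pathMeasure := by
  refine continuous_generateFrom_iff.2 ?_
  rintro _ ⟨b, rfl⟩
  have : pathMeasure ⁻¹' basicOpen b =
      ⋂ t ∈ b, {p | (t.1 : ℝ) < mass p t.2.1} ∩ {p | mass p t.2.1 < (t.2.2 : ℝ)} := by
    ext p
    simp only [Set.mem_preimage, Set.mem_iInter]
    change (∀ t ∈ b, _) ↔ _
    simp only [coe_pathMeasure_cylinderSet]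
    rfl
  rw [this]
  exact isOpen_biInter_finset fun t _ =>
    (isOpen_lt continuous_const (continuous_mass _)).inter
      (isOpen_lt (continuous_mass _) continuous_const)

theorem isCompact_compatibleMeasures (φ : ForecastingSystem) :
    @IsCompact _ measureTopology (compatibleMeasures φ) := by
  rw [compatibleMeasures_eq]
  exact @IsCompact.image _ _ _ measureTopology _ _ (isCompact_forecastBox φ) continuous_pathMeasure

theorem abs_coin_sub_coin (p p' : Situation → unitInterval) (s : Situation) (b : Bool) :
    |coin p s b - coin p' s b| = |(p s : ℝ) - p' s| := by
  cases b
  · simp only [coin, Bool.false_eq_true, if_false]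
    rw [sub_sub_sub_cancel_left, abs_sub_comm]
  · simp [coin]

/-- Exchange the factors one at a time: all of them lie in [0, 1], so each exchange costs at most
`δ`. Only the forecasts at proper prefixes of `s` enter. -/
theorem abs_mass_sub_mass_le {p p' : Situation → unitInterval} {δ : ℝ} (s : Situation)
    (h : ∀ i < s.length, |(p (s.take i) : ℝ) - p' (s.take i)| ≤ δ) :
    |mass p s - mass p' s| ≤ s.length * δ := by
  induction s using List.reverseRecOn with
  | nil => simp [mass]
  | append_singleton s b ih =>
    have h1 := ih fun i hi => by
      have := h i (by simp; omega)
      rwa [List.take_append_of_le_length hi.le] at this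
    have h2 := h s.length (by simp)
    rw [List.take_append_of_le_length le_rfl, List.take_length, ← abs_coin_sub_coin p p' s b] at h2
    rw [mass_append, mass_append]
    have h3 : mass p s * coin p s b - mass p' s * coin p' s b =
        (mass p s - mass p' s) * coin p s b + mass p' s * (coin p s b - coin p' s b) := by ring
    have h4 : |(mass p s - mass p' s) * coin p s b| ≤ |mass p s - mass p' s| := by
      rw [abs_mul, abs_of_nonneg (coin_nonneg p s b)]
      exact mul_le_of_le_one_right (abs_nonneg _) (coin_le_one p s b)
    have h5 : |mass p' s * (coin p s b - coin p' s b)| ≤ |coin p s b - coin p' s b| := by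
      rw [abs_mul, abs_of_nonneg (mass_nonneg p' s)]
      exact mul_le_of_le_one_left (abs_nonneg _) (mass_le_one p' s)
    rw [h3]
    refine (abs_add_le _ _).trans ?_
    rw [List.length_append, List.length_singleton]
    push_cast
    linarith

/-- The situations with code at most `m`. -/
def situationsUpTo (m : ℕ) : List Situation :=
  (List.range (m + 1)).filterMap (Encodable.decode₂ Situation)

theorem mem_situationsUpTo {m : ℕ} {s : Situation} :
    s ∈ situationsUpTo m ↔ Encodable.encode s ≤ m := by
  simp [situationsUpTo, Encodable.decode₂_eq_some]

theorem primrec_situationsUpTo : Primrec situationsUpTo :=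
  Primrec.listFilterMap (Primrec.list_range.comp Primrec.succ)
    (Primrec.decode₂.comp Primrec.snd)

/-- The numerator of the forecast in the situation `s`, among the forecasts with denominator
`m + 1` that are encoded by `n`. -/
def gridDigit (m n : ℕ) (s : Situation) : ℕ := n / (m + 2) ^ Encodable.encode s % (m + 2)

theorem gridDigit_le (m n : ℕ) (s : Situation) : gridDigit m n s ≤ m + 1 :=
  Nat.le_of_lt_succ (Nat.mod_lt _ (Nat.succ_pos _))

/-- The forecasts with denominator `m + 1` that are encoded by `n`. -/
def gridForecast (m n : ℕ) (s : Situation) : unitInterval :=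
  ⟨gridDigit m n s / (m + 1), by positivity,
    (div_le_one (by positivity)).2 (by exact_mod_cast gridDigit_le m n s)⟩

theorem coe_gridForecast (m n : ℕ) (s : Situation) :
    (gridForecast m n s : ℝ) = gridDigit m n s / (m + 1) := rfl

theorem exists_gridForecast (p : Situation → unitInterval) (m : ℕ) :
    ∃ n < (m + 2) ^ (m + 1), ∀ s, Encodable.encode s ≤ m →
      (gridForecast m n s : ℝ) ≤ p s ∧ (p s : ℝ) ≤ gridForecast m n s + 1 / (m + 1) := by
  have hm : (0 : ℝ) < m + 1 := by positivity
  -- Round each forecast down to the grid. Digits range over 0, ..., m + 1, hence base `m + 2`; the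
  -- default `[]` covers numbers that code no situation and is harmless.
  obtain ⟨n, hn, h⟩ := exists_digits (b := m + 2)
    (d := fun i => ⌊(p ((Encodable.decode i).getD []) : ℝ) * (m + 1)⌋₊) (fun i => by
      have h1 : (p ((Encodable.decode i).getD []) : ℝ) ≤ 1 := (p _).2.2
      refine Nat.lt_succ_of_le (Nat.floor_le_of_le ?_)
      push_cast
      exact mul_le_of_le_one_left hm.le h1) (m + 1)
  refine ⟨n, hn, fun s hs => ?_⟩
  have h1 : gridDigit m n s = ⌊(p s : ℝ) * (m + 1)⌋₊ := by
    simpa [gridDigit] using h (Encodable.encode s) (by omega)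
  have h0 : (0 : ℝ) ≤ p s := (p s).2.1
  rw [coe_gridForecast, h1, ← add_div]
  exact ⟨(div_le_iff₀ hm).2 (Nat.floor_le (by positivity)),
    (le_div_iff₀ hm).2 (Nat.lt_floor_add_one _).le⟩

/-- A code of the probability of a situation, for the forecasts encoded by `n`. -/
def massCode (m n : ℕ) (s : Situation) : RatCode :=
  (s.foldl (fun (t : Situation × RatCode) b => (t.1 ++ [b], mulCode t.2
    ((bif b then gridDigit m n t.1 else m + 1 - gridDigit m n t.1), 0, m))) ([], (1, 0, 0))).2

theorem coe_decodeRat_massCode (m n : ℕ) (s : Situation) :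
    (decodeRat (massCode m n s) : ℝ) = mass (gridForecast m n) s := by
  -- The first component of the fold is the prefix read so far, where the next forecast is
  -- evaluated.
  have hfst : ∀ s : Situation, (s.foldl (fun (t : Situation × RatCode) b => (t.1 ++ [b],
      mulCode t.2 ((bif b then gridDigit m n t.1 else m + 1 - gridDigit m n t.1), 0, m)))
        ([], (1, 0, 0))).1 = s := by
    intro s
    induction s using List.reverseRecOn with
    | nil => rfl
    | append_singleton s b ih => rw [List.foldl_append, List.foldl_cons, List.foldl_nil, ih]
  induction s using List.reverseRecOn with
  | nil => simp [massCode, mass, decodeRat]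
  | append_singleton s b ih =>
    have hm : (m : ℝ) + 1 ≠ 0 := by positivity
    have : massCode m n (s ++ [b]) = mulCode (massCode m n s)
        ((bif b then gridDigit m n s else m + 1 - gridDigit m n s), 0, m) := by
      rw [massCode, List.foldl_append, List.foldl_cons, List.foldl_nil, hfst]
      rfl
    rw [this, decodeRat_mulCode, mass_append, ← ih]
    push_cast
    congr 1
    cases b
    · simp only [cond_false, decodeRat, coin, Bool.false_eq_true, if_false, coe_gridForecast]
      push_cast [Nat.cast_sub (gridDigit_le m n s)]
      field_simp
      ring
    · simp [decodeRat, coin, coe_gridForecast]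

theorem primrec_gridDigit : Primrec fun a : (ℕ × ℕ) × Situation => gridDigit a.1.1 a.1.2 a.2 := by
  have hb : Primrec fun a : (ℕ × ℕ) × Situation => a.1.1 + 2 :=
    Primrec.succ.comp (Primrec.succ.comp (Primrec.fst.comp Primrec.fst))
  exact Primrec.nat_mod.comp (Primrec.nat_div.comp (Primrec.snd.comp Primrec.fst)
    (primrec₂_pow.comp hb (Primrec.encode.comp Primrec.snd))) hb

theorem primrec_massCode : Primrec fun a : (ℕ × ℕ) × Situation => massCode a.1.1 a.1.2 a.2 := by
  refine Primrec.snd.comp (Primrec.list_foldl (α := (ℕ × ℕ) × Situation) (β := Bool)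
    (σ := Situation × RatCode) (f := fun a => a.2) (g := fun _ => ([], (1, 0, 0)))
    (h := fun a x => (x.1.1 ++ [x.2], mulCode x.1.2 ((bif x.2 then gridDigit a.1.1 a.1.2 x.1.1
      else a.1.1 + 1 - gridDigit a.1.1 a.1.2 x.1.1), 0, a.1.1)))
    Primrec.snd (Primrec.const _) ?_)
  let A := ((ℕ × ℕ) × Situation) × (Situation × RatCode) × Bool
  have hm : Primrec fun a : A => a.1.1.1 := Primrec.fst.comp (Primrec.fst.comp Primrec.fst)
  have hmn : Primrec fun a : A => a.1.1 := Primrec.fst.comp Primrec.fst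
  have ht : Primrec fun a : A => a.2.1.1 := Primrec.fst.comp (Primrec.fst.comp Primrec.snd)
  have hc : Primrec fun a : A => a.2.1.2 := Primrec.snd.comp (Primrec.fst.comp Primrec.snd)
  have hb : Primrec fun a : A => a.2.2 := Primrec.snd.comp Primrec.snd
  have hd : Primrec fun a : A => gridDigit a.1.1.1 a.1.1.2 a.2.1.1 :=
    primrec_gridDigit.comp (hmn.pair ht)
  exact (Primrec.list_concat.comp ht hb).pair (primrec₂_mulCode.comp hc
    ((Primrec.cond hb hd (Primrec.nat_sub.comp (Primrec.succ.comp hm) hd)).pair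
      ((Primrec.const 0).pair hm)))

/-- The forecasts encoded by `n` are too far from the approximate bounds in some situation. -/
def GridViolation (cl cu : Situation → ℕ → RatCode) (m n : ℕ) : Prop :=
  ∃ s ∈ situationsUpTo m,
    decodeRat (addCode (gridDigit m n s, 0, m) (1, 0, m)) < decodeRat (cl s m) ∨
      decodeRat (1, 0, m) < decodeRat (addCode (gridDigit m n s, 0, m) (cu s m))

/-- The measure of all forecasts close to those encoded by `n` satisfies the basic open
condition `x`. -/
def RobustMem (m n : ℕ) (x : RatCode × Situation × RatCode) : Prop :=
  (∀ i ∈ List.range x.2.1.length, Encodable.encode (x.2.1.take i) ≤ m) ∧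
    decodeRat (addCode x.1 (x.2.1.length, 0, m)) < decodeRat (massCode m n x.2.1) ∧
      decodeRat (addCode (massCode m n x.2.1) (x.2.1.length, 0, m)) < decodeRat x.2.2

/-- A finite test for covers of the class of compatible measures. -/
def GridTest (cl cu : Situation → ℕ → RatCode) (c : List GeneratorCode) (m : ℕ) : Prop :=
  ∀ n ∈ List.range ((m + 2) ^ (m + 1)),
    GridViolation cl cu m n ∨ ∃ b ∈ c, ∀ x ∈ b, RobustMem m n x

theorem primrecPred_gridViolation {cl cu : Situation → ℕ → RatCode} (hcl : Primrec₂ cl)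
    (hcu : Primrec₂ cu) : PrimrecPred fun a : ℕ × ℕ => GridViolation cl cu a.1 a.2 := by
  refine primrecPred_exists_mem (primrec_situationsUpTo.comp Primrec.fst) ?_
  have hm : Primrec fun a : (ℕ × ℕ) × Situation => a.1.1 := Primrec.fst.comp Primrec.fst
  have hd : Primrec fun a : (ℕ × ℕ) × Situation =>
      ((gridDigit a.1.1 a.1.2 a.2, 0, a.1.1) : RatCode) :=
    primrec_gridDigit.pair ((Primrec.const 0).pair hm)
  have h1 : Primrec fun a : (ℕ × ℕ) × Situation => ((1, 0, a.1.1) : RatCode) :=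
    (Primrec.const 1).pair ((Primrec.const 0).pair hm)
  exact (primrecRel_decodeRat_lt.comp (primrec₂_addCode.comp hd h1) (hcl.comp Primrec.snd hm)).or
    (primrecRel_decodeRat_lt.comp h1 (primrec₂_addCode.comp hd (hcu.comp Primrec.snd hm)))

theorem primrecPred_robustMem :
    PrimrecPred fun a : (ℕ × ℕ) × RatCode × Situation × RatCode => RobustMem a.1.1 a.1.2 a.2 := by
  have hm : Primrec fun a : (ℕ × ℕ) × RatCode × Situation × RatCode => a.1.1 := Primrec.fst.comp Primrec.fst
  have hu : Primrec fun a : (ℕ × ℕ) × RatCode × Situation × RatCode => a.2.1 := Primrec.fst.comp Primrec.snd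
  have hs : Primrec fun a : (ℕ × ℕ) × RatCode × Situation × RatCode => a.2.2.1 := Primrec.fst.comp (Primrec.snd.comp Primrec.snd)
  have hv : Primrec fun a : (ℕ × ℕ) × RatCode × Situation × RatCode => a.2.2.2 := Primrec.snd.comp (Primrec.snd.comp Primrec.snd)
  have hl : Primrec fun a : (ℕ × ℕ) × RatCode × Situation × RatCode => a.2.2.1.length := Primrec.list_length.comp hs
  have hε : Primrec fun a : (ℕ × ℕ) × RatCode × Situation × RatCode => ((a.2.2.1.length, 0, a.1.1) : RatCode) :=
    hl.pair ((Primrec.const 0).pair hm)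
  have hx : Primrec fun a : (ℕ × ℕ) × RatCode × Situation × RatCode => massCode a.1.1 a.1.2 a.2.2.1 :=
    Primrec.comp (f := fun a : (ℕ × ℕ) × Situation => massCode a.1.1 a.1.2 a.2)
      (g := fun a : (ℕ × ℕ) × RatCode × Situation × RatCode => (a.1, a.2.2.1))
      primrec_massCode (Primrec.fst.pair hs)
  have h1 : PrimrecPred fun a : (ℕ × ℕ) × RatCode × Situation × RatCode => ∀ i ∈ List.range a.2.2.1.length,
      Encodable.encode (a.2.2.1.take i) ≤ a.1.1 :=
    primrecPred_forall_mem (Primrec.list_range.comp hl) (Primrec.nat_le.comp (Primrec.encode.comp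
      (Primrec.list_take.comp Primrec.snd (hs.comp Primrec.fst))) (hm.comp Primrec.fst))
  have h2 := primrecRel_decodeRat_lt.comp (primrec₂_addCode.comp hu hε) hx
  have h3 := primrecRel_decodeRat_lt.comp (primrec₂_addCode.comp hx hε) hv
  exact h1.and (h2.and h3)

theorem primrecRel_gridTest {cl cu : Situation → ℕ → RatCode} (hcl : Primrec₂ cl)
    (hcu : Primrec₂ cu) : PrimrecRel (GridTest cl cu) := by
  let A := List GeneratorCode × ℕ
  have hm : Primrec fun a : A => a.2 := Primrec.snd
  refine primrecPred_forall_mem (α := A) (Primrec.list_range.comp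
    (primrec₂_pow.comp (Primrec.succ.comp (Primrec.succ.comp hm)) (Primrec.succ.comp hm))) ?_
  have hmn : Primrec fun a : A × ℕ => (a.1.2, a.2) := (hm.comp Primrec.fst).pair Primrec.snd
  refine ((primrecPred_gridViolation hcl hcu).comp hmn).or ?_
  refine primrecPred_exists_mem (Primrec.fst.comp Primrec.fst) ?_
  refine primrecPred_forall_mem (α := (A × ℕ) × GeneratorCode) Primrec.snd ?_
  exact primrecPred_robustMem.comp
    ((hmn.comp (Primrec.fst.comp Primrec.fst)).pair Primrec.snd)

/-! ### Soundness and completeness of the grid test -/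

theorem coe_decodeRat_addCode (c : RatCode) (k m : ℕ) :
    (decodeRat (addCode c (k, 0, m)) : ℝ) = decodeRat c + k / (m + 1) := by
  rw [decodeRat_addCode]
  simp [decodeRat]

theorem gridViolation_iff {cl cu : Situation → ℕ → RatCode} {m n : ℕ} :
    GridViolation cl cu m n ↔ ∃ s, Encodable.encode s ≤ m ∧
      ((gridForecast m n s : ℝ) + 1 / (m + 1) < decodeRat (cl s m) ∨
        1 / ((m : ℝ) + 1) < gridForecast m n s + decodeRat (cu s m)) := by
  simp only [GridViolation, mem_situationsUpTo, decodeRat_addCode, coe_gridForecast,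
    ← Rat.cast_lt (K := ℝ)]
  simp [decodeRat]

theorem robustMem_iff {m n : ℕ} {x : RatCode × Situation × RatCode} :
    RobustMem m n x ↔ (∀ i < x.2.1.length, Encodable.encode (x.2.1.take i) ≤ m) ∧
      (decodeRat x.1 : ℝ) + x.2.1.length / (m + 1) < mass (gridForecast m n) x.2.1 ∧
        mass (gridForecast m n) x.2.1 + x.2.1.length / (m + 1) < (decodeRat x.2.2 : ℝ) := by
  simp only [RobustMem, List.mem_range, ← Rat.cast_lt (K := ℝ), coe_decodeRat_addCode,
    coe_decodeRat_massCode]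

theorem mem_decodeFamily_cover {c : List GeneratorCode} {μ : ProbabilityMeasure Path} :
    μ ∈ ⋃ b ∈ decodeFamily c, basicOpen b ↔ ∃ b ∈ c, μ ∈ basicOpen (decodeGenerator b) := by
  simp only [decodeFamily, Set.mem_iUnion, List.mem_toFinset, List.mem_map, exists_prop,
    exists_exists_and_eq_and]

section Test

variable {φ : ForecastingSystem} {cl cu : Situation → ℕ → RatCode}

/-- Round a compatible `p` down to the grid. The rounding error is at most 1 / (m + 1), so the grid
point cannot be a violation, and the robust margin absorbs the resulting error in the masses. -/
theorem GridTest.cover (hcl : ∀ s n, (decodeRat (cl s n) : ℝ) ≤ lowerBound φ s)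
    (hcu : ∀ s n, (decodeRat (cu s n) : ℝ) ≤ -upperBound φ s) {c : List GeneratorCode} {m : ℕ}
    (h : GridTest cl cu c m) : compatibleMeasures φ ⊆ ⋃ b ∈ decodeFamily c, basicOpen b := by
  rw [compatibleMeasures_eq]
  rintro _ ⟨p, hp, rfl⟩
  rw [mem_forecastBox] at hp
  obtain ⟨n, hn, hgrid⟩ := exists_gridForecast p m
  rw [mem_decodeFamily_cover]
  rcases h n (List.mem_range.2 hn) with hviol | ⟨b, hb, hrob⟩
  · obtain ⟨s, hs, h1⟩ := gridViolation_iff.1 hviol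
    obtain ⟨h2, h3⟩ := hgrid s hs
    obtain ⟨h4, h5⟩ := hp s
    have h6 : (0 : ℝ) < 1 / (m + 1) := by positivity
    rcases h1 with h1 | h1
    · linarith [hcl s m]
    · linarith [hcu s m]
  · refine ⟨b, hb, pathMeasure_mem_basicOpen.2 fun x hx => ?_⟩
    obtain ⟨h1, h2, h3⟩ := robustMem_iff.1 (hrob x hx)
    have h4 := abs_mass_sub_mass_le (p := p) (p' := gridForecast m n) (δ := 1 / (m + 1)) x.2.1
      fun i hi => by
        obtain ⟨h5, h6⟩ := hgrid _ (h1 i hi)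
        rw [abs_le]
        constructor <;> linarith
    rw [mul_one_div, abs_le] at h4
    constructor <;> linarith

/-- Completeness comes from compactness: the failing grid points accumulate at a compatible
forecast, and the open set that covers its measure also covers nearby grid points with margin. -/
theorem exists_gridTest
    (hcl : ∀ s, Tendsto (fun n => (decodeRat (cl s n) : ℝ)) atTop (𝓝 (lowerBound φ s)))
    (hcu : ∀ s, Tendsto (fun n => (decodeRat (cu s n) : ℝ)) atTop (𝓝 (-upperBound φ s)))
    {c : List GeneratorCode}
    (h : compatibleMeasures φ ⊆ ⋃ b ∈ decodeFamily c, basicOpen b) : ∃ m, GridTest cl cu c m := by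
  by_contra! hne
  have hbad : ∀ m, ∃ n, ¬GridViolation cl cu m n ∧ ∀ b ∈ c, ∃ x ∈ b, ¬RobustMem m n x := by
    intro m
    have := hne m
    unfold GridTest at this
    push Not at this
    obtain ⟨n, -, h1⟩ := this
    exact ⟨n, h1⟩
  choose n hviol hrob using hbad
  obtain ⟨p, θ, hθ, hlim⟩ := CompactSpace.tendsto_subseq fun m => gridForecast m (n m)
  have hθ' := hθ.tendsto_atTop
  have hps : ∀ s, Tendsto (fun k => (gridForecast (θ k) (n (θ k)) s : ℝ)) atTop (𝓝 (p s)) :=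
    fun s => (continuous_subtype_val.tendsto _).comp ((tendsto_pi_nhds.1 hlim) s)
  have hinv : Tendsto (fun k => 1 / ((θ k : ℝ) + 1)) atTop (𝓝 0) :=
    tendsto_one_div_add_atTop_nhds_zero_nat.comp hθ'
  -- Non-violation holds up to an error that vanishes along the subsequence, and the approximate
  -- bounds converge, so the limit obeys the exact bounds.
  have hp : p ∈ forecastBox φ := by
    rw [mem_forecastBox]
    intro s
    have hev : ∀ᶠ k in atTop,
        (decodeRat (cl s (θ k)) : ℝ) ≤ gridForecast (θ k) (n (θ k)) s + 1 / ((θ k : ℝ) + 1) ∧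
          gridForecast (θ k) (n (θ k)) s + (decodeRat (cu s (θ k)) : ℝ) ≤
            1 / ((θ k : ℝ) + 1) := by
      filter_upwards [hθ'.eventually_ge_atTop (Encodable.encode s)] with k hk
      have := hviol (θ k)
      rw [gridViolation_iff] at this
      push Not at this
      exact this s hk
    constructor
    · have := le_of_tendsto_of_tendsto ((hcl s).comp hθ') ((hps s).add hinv)
        (hev.mono fun k hk => hk.1)
      simpa using this
    · have := le_of_tendsto_of_tendsto ((hps s).add ((hcu s).comp hθ')) hinv
        (hev.mono fun k hk => hk.2)
      linarith
  have hmem := h ((compatibleMeasures_eq φ).symm ▸ Set.mem_image_of_mem _ hp)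
  obtain ⟨b, hb, hμ⟩ := mem_decodeFamily_cover.1 hmem
  rw [pathMeasure_mem_basicOpen] at hμ
  -- The strict inequalities at the limit survive the vanishing margin, and `b` imposes only
  -- finitely many conditions, so they all hold from a common index on.
  have hev : ∀ᶠ k in atTop, ∀ x ∈ {x | x ∈ b}, RobustMem (θ k) (n (θ k)) x := by
    refine (eventually_all_finite (List.finite_toSet b)).2 fun x hx => ?_
    obtain ⟨h1, h2⟩ := hμ x hx
    have hmass : Tendsto (fun k => mass (gridForecast (θ k) (n (θ k))) x.2.1) atTop
        (𝓝 (mass p x.2.1)) := ((continuous_mass x.2.1).tendsto p).comp hlim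
    have hε : Tendsto (fun k => (x.2.1.length : ℝ) / ((θ k : ℝ) + 1)) atTop (𝓝 0) := by
      simpa [div_eq_mul_inv] using hinv.const_mul (x.2.1.length : ℝ)
    have e1 := (hε.const_add (decodeRat x.1 : ℝ)).eventually_lt hmass (by simpa using h1)
    have e2 := (hmass.add hε).eventually_lt tendsto_const_nhds
      (by simpa using h2 : mass p x.2.1 + 0 < (decodeRat x.2.2 : ℝ))
    have e3 : ∀ᶠ k in atTop, ∀ i ∈ Set.Iio x.2.1.length,
        Encodable.encode (x.2.1.take i) ≤ θ k :=
      (eventually_all_finite (Set.finite_Iio _)).2 fun i _ => hθ'.eventually_ge_atTop _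
    filter_upwards [e1, e2, e3] with k h3 h4 h5
    exact robustMem_iff.2 ⟨h5, h3, h4⟩
  obtain ⟨k, hk⟩ := hev.exists
  obtain ⟨x, hx, hnot⟩ := hrob (θ k) b hb
  exact hnot (hk x hx)

end Test

theorem effectivelyCompact_compatibleMeasures {φ : ForecastingSystem}
    (hlower : LowerSemicomputable (lowerBound φ)) (hupper : UpperSemicomputable (upperBound φ)) :
    EffectivelyCompact (compatibleMeasures φ) := by
  obtain ⟨cl, hcl, hcl_le, hcl_lim⟩ := hlower.exists_primrec fun s => by
    have := (φ s).fst.2.1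
    exact (by norm_num : (-1 : ℝ) ≤ 0).trans this
  obtain ⟨cu, hcu, hcu_le, hcu_lim⟩ := LowerSemicomputable.exists_primrec hupper fun s => by
    have := (φ s).snd.2.2
    exact neg_le_neg this
  refine ⟨isCompact_compatibleMeasures φ, ?_⟩
  refine (rePred_exists_nat (primrecRel_gridTest hcl hcu)).of_eq fun c => ?_
  exact ⟨fun ⟨_, hm⟩ => hm.cover hcl_le hcu_le, exists_gridTest hcl_lim hcu_lim⟩

end Forecasting

end

theorem mainTheorem6 (φ : Forecasting.ForecastingSystem)
    (hφ : Forecasting.ComputableForecast φ)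
    (hlower : Forecasting.LowerSemicomputable (Forecasting.lowerBound φ))
    (hupper : Forecasting.UpperSemicomputable (Forecasting.upperBound φ)) :
    (∀ ψ : Forecasting.ForecastingSystem, Forecasting.IsPrecise ψ → Forecasting.Compatible ψ φ →
      ∃! μ : MeasureTheory.ProbabilityMeasure Forecasting.Path, Forecasting.Generates ψ μ) ∧
    Forecasting.EffectivelyClosed (Forecasting.compatibleMeasures φ) ∧
    Forecasting.EffectivelyCompact (Forecasting.compatibleMeasures φ) := by
  refine ⟨fun ψ hψ _ => hψ.existsUnique_generates, ?_, ?_⟩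
  · exact Forecasting.effectivelyClosed_compatibleMeasures hlower hupper
  · exact Forecasting.effectivelyCompact_compatibleMeasures hlower hupper
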